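/- Let $\Omega\subseteq\mathbb R^2$ be open and star-shaped with respect to the origin (in particular $0\in\Omega$), let $\delta\in C^\infty(\Omega)$ be positive, and let $M=(\Omega,\ \delta^{-2}(dx^2+dy^2))$; thus $M$ is a non-compact simply connected Riemannian surface. Its Cheeger constant is $$\mathrm{Ch}(M)=\inf\left\{\frac{\mathrm{Length}(\partial D)}{\mathrm{Area}(D)}\ :\ D\subset M \text{ non-empty, open, relatively compact in } M,\ \partial D \text{ a smooth embedded curve (possibly with several components)}\right\}.$$ For $\tau\in C^\infty(\Omega)$ put $\mathbf C_{\delta,\tau}(x,y)=2\int_0^1 t\,\tau(tx,ty)\,\delta(tx,ty)^{-2}\,dt$. Let $\mathbb E^3(M,\tau)$ be $\Omega\times\mathbb R$ with the Riemannian metric $$\delta^{-2}(dx^2+dy^2)+\bigl(dz+\mathbf C_{\delta,\tau}\,(y\,dx-x\,dy)\bigr)^2,$$ and let $\mathbb L^3(M,\tau)$ be $\Omega\times\mathbb R$ with the Lorentzian metric $$\delta^{-2}(dx^2+dy^2)-\bigl(dz-\mathbf C_{\delta,\tau}\,(y\,dx-x\,dy)\bigr)^2.$$ An entire graph is a surface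 $\{z=u(x,y):(x,y)\in\Omega\}$ with $u\in C^2(\Omega)$; in $\mathbb E^3(M,\tau)$ its mean curvature is half the trace of the second fundamental form with respect to the upward unit normal $N$ (that is, $\langle N,\partial_z\rangle>0$), as a function on $\Omega$. A spacelike surface in $\mathbb L^3(M,\tau)$ is a non-empty surface (a $2$-manifold without boundary, of class $C^2$) with a $C^2$ immersion in $\mathbb L^3(M,\tau)$ whose induced metric is positive definite; it is complete if it is complete for the distance of the induced metric. An entire graph in $\mathbb L^3(M,\tau)$ is spacelike if its induced metric is positive definite. Then: (a) If $H\in C^\infty(\Omega)$ satisfies $\inf_\Omega|H|>\tfrac12\mathrm{Ch}(M)$, then for every $\tau\in C^\infty(\Omega)$ the space $\mathbb E^3(M,\tau)$ admits no entire graph with mean curvature function $H$. (b) If $\tau\in C^\infty(\Omega)$ satisfies $\inf_\Omega|\tau|>\tfrac12\mathrm{Ch}(M)$, then $\mathbb L^3(M,\tau)$ admits neither a complete spacelike surface nor an entire spacelike graph. -/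

import Mathlib

open Set Filter Topology MeasureTheory
open scoped ENNReal ContDiff Manifold

noncomputable section

namespace GBCV

/-- The Euclidean plane with its coordinates `p 0` (that is, `x`) and `p 1` (that is, `y`). -/
abbrev Plane : Type := EuclideanSpace ℝ (Fin 2)

/-- The ambient coordinate space: `q = (p, z)` with `p` in the plane. It also serves as the tangent
space at each of its points. -/
abbrev Space : Type := Plane × ℝ

/-! ### The base surface `M = (Ω, δ⁻² (dx² + dy²))` and its Cheeger constant -/

/-- The area of `D` for the metric `δ⁻² (dx² + dy²)`. -/
def area (δ : Plane → ℝ) (D : Set Plane) : ℝ≥0∞ :=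
  ∫⁻ p in D, ENNReal.ofReal ((δ p)⁻¹ ^ 2)

/-- The length of a curve `c` (as a set of points) for the metric `δ⁻² (dx² + dy²)`: the integral
of `δ⁻¹` with respect to Euclidean arc length. -/
def length (δ : Plane → ℝ) (c : Set Plane) : ℝ≥0∞ :=
  ∫⁻ p in c, ENNReal.ofReal (δ p)⁻¹ ∂μH[1]

/-- `c` is a smooth (embedded) curve in the plane: near each of its points it is the zero set of a
smooth function with nowhere vanishing differential. It may have several components. -/
def IsSmoothCurve (c : Set Plane) : Prop :=
  ∀ p ∈ c, ∃ (U : Set Plane) (φ : Plane → ℝ), IsOpen U ∧ p ∈ U ∧ ContDiffOn ℝ ∞ φ U ∧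
    (∀ q ∈ U, fderiv ℝ φ q ≠ 0) ∧ c ∩ U = {q ∈ U | φ q = 0}

/-- `D` is a (non-empty) open regular subset of `Ω`: it is relatively compact in `Ω` and its
boundary is a smooth curve. -/
structure IsRegular (Ω D : Set Plane) : Prop where
  nonempty : D.Nonempty
  isOpen : IsOpen D
  isCompact_closure : IsCompact (closure D)
  closure_subset : closure D ⊆ Ω
  isSmoothCurve_frontier : IsSmoothCurve (frontier D)

/-- The Cheeger constant of `(Ω, δ⁻² (dx² + dy²))`. -/
def cheeger (Ω : Set Plane) (δ : Plane → ℝ) : ℝ≥0∞ :=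
  ⨅ (D : Set Plane) (_ : IsRegular Ω D), length δ (frontier D) / area δ D

/-! ### The GBCV metrics -/

/-- The Calabi potential `C(p) = 2 ∫₀¹ t τ(t p) / δ(t p)² dt`. -/
def calabi (δ τ : Plane → ℝ) (p : Plane) : ℝ :=
  2 * ∫ t in (0 : ℝ)..1, t * (τ (t • p) / δ (t • p) ^ 2)

/-- The metric `δ⁻² (dx² + dy²)` on the base, at `p`. -/
def baseMetric (δ : Plane → ℝ) (p a b : Plane) : ℝ :=
  (a 0 * b 0 + a 1 * b 1) / δ p ^ 2

/-- The one-form `dz + C (y dx - x dy)` at `q`. -/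
def formE (δ τ : Plane → ℝ) (q v : Space) : ℝ :=
  v.2 + calabi δ τ q.1 * (q.1 1 * v.1 0 - q.1 0 * v.1 1)

/-- The one-form `dz - C (y dx - x dy)` at `q`. -/
def formL (δ τ : Plane → ℝ) (q v : Space) : ℝ :=
  v.2 - calabi δ τ q.1 * (q.1 1 * v.1 0 - q.1 0 * v.1 1)

/-- The Riemannian metric of `𝔼³(M, τ)` at `q`. -/
def metricE (δ τ : Plane → ℝ) (q v w : Space) : ℝ :=
  baseMetric δ q.1 v.1 w.1 + formE δ τ q v * formE δ τ q w

/-- The Lorentzian metric of `𝕃³(M, τ)` at `q`. -/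
def metricL (δ τ : Plane → ℝ) (q v w : Space) : ℝ :=
  baseMetric δ q.1 v.1 w.1 - formL δ τ q v * formL δ τ q w

/-! ### Mean curvature of parametrized surfaces -/

/-- The Christoffel symbols of the first kind of a metric `g` at `q`: the value `g(∇_v w, n)` of the
Levi-Civita connection on vector fields `v`, `w`, `n` with constant coordinates. -/
def christoffel (g : Space → Space → Space → ℝ) (q v w n : Space) : ℝ :=
  (fderiv ℝ (fun q' => g q' w n) q v + fderiv ℝ (fun q' => g q' v n) q w
    - fderiv ℝ (fun q' => g q' v w) q n) / 2

/-- The `i`-th coordinate tangent vector at `p` of a parametrized surface `X`. -/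
def tangent (X : Plane → Space) (i : Fin 2) (p : Plane) : Space :=
  fderiv ℝ X p (EuclideanSpace.single i 1)

/-- The matrix of the first fundamental form of `X` at `p`. -/
def firstForm (g : Space → Space → Space → ℝ) (X : Plane → Space) (p : Plane) :
    Matrix (Fin 2) (Fin 2) ℝ :=
  Matrix.of fun i j => g (X p) (tangent X i p) (tangent X j p)

/-- The matrix `g(∇_{∂ᵢ} ∂ⱼ X, N)` of the second fundamental form of `X` at `p` with respect to the
normal vector `N`. -/
def secondForm (g : Space → Space → Space → ℝ) (X : Plane → Space) (p : Plane) (N : Space) :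
    Matrix (Fin 2) (Fin 2) ℝ :=
  Matrix.of fun i j =>
    g (X p) (fderiv ℝ (tangent X j) p (EuclideanSpace.single i 1)) N
      + christoffel g (X p) (tangent X i p) (tangent X j p) N

/-- The mean curvature of `X` at `p` with respect to the unit normal `N`: half the trace of the
second fundamental form with respect to the first. -/
def meanCurvature (g : Space → Space → Space → ℝ) (X : Plane → Space) (p : Plane) (N : Space) :
    ℝ :=
  ((firstForm g X p)⁻¹ * secondForm g X p N).trace / 2

/-- `N` is the unit normal of `X` at `p` pointing upwards, i.e. `g(N, ∂_z) > 0`. -/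
def IsUpwardUnitNormal (g : Space → Space → Space → ℝ) (X : Plane → Space) (p : Plane)
    (N : Space) : Prop :=
  (∀ i, g (X p) (tangent X i p) N = 0) ∧ g (X p) N N = 1 ∧ 0 < g (X p) N (0, 1)

/-! ### Entire graphs -/

/-- The graph `z = u(x, y)` as a parametrized surface. -/
def graph (u : Plane → ℝ) (p : Plane) : Space := (p, u p)

/-- The graph of `u ∈ C²(Ω)` is an entire graph in `𝔼³(M, τ)` with mean curvature function `H`. -/
def IsEntireGraphWithMeanCurvature (Ω : Set Plane) (δ τ H u : Plane → ℝ) : Prop :=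
  ContDiffOn ℝ 2 u Ω ∧ ∀ p ∈ Ω, ∃ N : Space, IsUpwardUnitNormal (metricE δ τ) (graph u) p N ∧
    meanCurvature (metricE δ τ) (graph u) p N = H p

/-- The graph of `u ∈ C²(Ω)` is an entire spacelike graph in `𝕃³(M, τ)`: the induced metric is
positive definite. -/
def IsEntireSpacelikeGraph (Ω : Set Plane) (δ τ u : Plane → ℝ) : Prop :=
  ContDiffOn ℝ 2 u Ω ∧ ∀ p ∈ Ω, ∀ a : Plane, a ≠ 0 →
    0 < metricL δ τ (graph u p) (fderiv ℝ (graph u) p a) (fderiv ℝ (graph u) p a)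

/-! ### Complete spacelike surfaces -/

section Surface

variable {S : Type*} [TopologicalSpace S] [ChartedSpace Plane S]

/-- The metric of `𝕃³(M, τ)` pulled back by `f : S → Ω × ℝ`, at `s`. -/
def inducedMetric (δ τ : Plane → ℝ) (f : S → Space) (s : S)
    (a b : TangentSpace 𝓘(ℝ, Plane) s) : ℝ :=
  metricL δ τ (f s) (mfderiv 𝓘(ℝ, Plane) 𝓘(ℝ, Space) f s a)
    (mfderiv 𝓘(ℝ, Plane) 𝓘(ℝ, Space) f s b)

/-- `f` is a spacelike immersion of class `C²` of the surface `S` in `𝕃³(M, τ)`: the induced metric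
is positive definite. -/
structure IsSpacelikeImmersion (Ω : Set Plane) (δ τ : Plane → ℝ) (f : S → Space) : Prop where
  contMDiff : ContMDiff 𝓘(ℝ, Plane) 𝓘(ℝ, Space) 2 f
  mem : ∀ s, (f s).1 ∈ Ω
  spacelike : ∀ (s : S) (a : TangentSpace 𝓘(ℝ, Plane) s), a ≠ 0 → 0 < inducedMetric δ τ f s a a

/-- The distance on `S` of the induced metric: the infimum of the lengths of `C¹` curves. -/
def inducedEDist (δ τ : Plane → ℝ) (f : S → Space) (s t : S) : ℝ≥0∞ :=
  letI : ∀ r : S, ENorm (TangentSpace 𝓘(ℝ, Plane) r) :=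
    fun r => ⟨fun a => ENNReal.ofReal √(inducedMetric δ τ f r a a)⟩
  Manifold.riemannianEDist 𝓘(ℝ, Plane) s t

/-- The induced metric on `S` is complete: each Cauchy sequence of the induced distance
converges. -/
def IsInducedComplete (δ τ : Plane → ℝ) (f : S → Space) : Prop :=
  ∀ σ : ℕ → S,
    (∀ ε : ℝ≥0∞, 0 < ε → ∃ N, ∀ m ≥ N, ∀ n ≥ N, inducedEDist δ τ f (σ m) (σ n) < ε) →
      ∃ s, Tendsto σ atTop (𝓝 s)

end Surface

end GBCV

end

/-! Both parts are a calibration argument. Suppose a plane field `F` on `Ω` satisfies `‖F‖ ≤ δ⁻¹`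
and has Euclidean divergence `2 h δ⁻²`. Equivalently, the vector field `δ² F` has norm at most one
on `M` and Riemannian divergence `2 h`. If `h ≥ 0`, the divergence theorem on a regular domain `D`
gives `2 inf h · Area(D) ≤ Length(∂D)`, so `2 inf h ≤ Ch(M)`. If `inf |h| > 0`, then `h` has
constant sign on the connected set `Ω`, and replacing `F` by `-F` covers the negative case. This is
`not_cheeger_lt_of_divergence`; each part only has to supply a field.

For a graph in `𝔼³(M, τ)`, let `(α, β) = (u_x + C y, u_y - C x)` and `W² = 1 + δ² (α² + β²)`. The
mean curvature equation is `div ((α, β) / W) = 2 H δ⁻²` (`meanCurvature_graph_eq`), and the field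
has the required bound by the definition of `W`.

For a graph in `𝕃³(M, τ)`, let `(α, β) = (u_x - C y, u_y + C x)`. Spacelike means `α² + β² < δ⁻²`.
In the divergence of the rotated field `(β, -α)` the second derivatives of `u` cancel, leaving `2 C
+ x C_x + y C_y`, which is `2 τ δ⁻²` by the choice of the Calabi potential (`calabi_identity`).

A complete spacelike surface is reduced to a graph. Its projection to `M` does not shorten curves,
because the vertical part of the metric is negative. The projection is therefore a local
diffeomorphism, and completeness makes segments lift. Lifting the rays from the origin gives a
section over the star-shaped `Ω`, hence an entire spacelike graph.

The divergence theorem is needed only as an inequality against one-dimensional Hausdorff measure. It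
is proved locally up to a factor `K > 1` in small squares where the boundary is almost straight,
summed with a partition of unity, and sharpened by `K → 1` (`ofReal_setIntegral_divergence_le`). -/

noncomputable section

namespace GBCV

/-! ### Integration by parts and cut-off functions -/

section

/-- The Euclidean divergence of a vector field on the plane. -/
def divergence (F : Plane → Plane) (p : Plane) : ℝ :=
  fderiv ℝ F p (EuclideanSpace.single 0 1) 0 + fderiv ℝ F p (EuclideanSpace.single 1 1) 1

theorem fderiv_coord {F : Plane → Plane} {p : Plane} (hF : DifferentiableAt ℝ F p) (i : Fin 2)
    (v : Plane) : fderiv ℝ (fun q => F q i) p v = fderiv ℝ F p v i := by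
  have h := (EuclideanSpace.proj (𝕜 := ℝ) i : Plane →L[ℝ] ℝ).hasFDerivAt.comp p
    hF.hasFDerivAt
  exact congrArg (fun L => L v) h.fderiv

theorem divergence_congr {F G : Plane → Plane} {p : Plane} (h : F =ᶠ[𝓝 p] G) :
    divergence F p = divergence G p := by
  simp only [divergence, h.fderiv_eq]

theorem continuous_divergence {F : Plane → Plane} (hF : ContDiff ℝ 1 F) :
    Continuous (divergence F) := by
  have h : Continuous (fderiv ℝ F) := hF.continuous_fderiv one_ne_zero
  unfold divergence
  fun_prop

theorem tsupport_divergence_subset (F : Plane → Plane) :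
    tsupport (divergence F) ⊆ tsupport F := by
  refine closure_minimal (fun p hp => ?_) (isClosed_tsupport F)
  by_contra h
  have h1 : F =ᶠ[𝓝 p] 0 := notMem_tsupport_iff_eventuallyEq.1 h
  apply hp
  rw [divergence_congr h1]
  simp [divergence]

theorem eq_sum_coord (w : Plane) :
    w = w 0 • EuclideanSpace.single (0 : Fin 2) (1 : ℝ)
      + w 1 • EuclideanSpace.single (1 : Fin 2) (1 : ℝ) := by
  ext i
  fin_cases i <;> simp

theorem continuous_mul_of_tsupport_subset {U : Set Plane} (hU : IsOpen U) {f g : Plane → ℝ}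
    (hf : ContinuousOn f U) (hg : Continuous g) (hgU : tsupport g ⊆ U) :
    Continuous fun q => f q * g q := by
  refine continuous_of_tsupport fun x hx => ?_
  have hx' : x ∈ tsupport g := tsupport_mul_subset_right hx
  exact (hf.continuousAt (hU.mem_nhds (hgU hx'))).mul hg.continuousAt

theorem integrable_mul_of_tsupport_subset {U : Set Plane} (hU : IsOpen U) {f g : Plane → ℝ}
    (hf : ContinuousOn f U) (hg : Continuous g) (hgU : tsupport g ⊆ U)
    (hgc : HasCompactSupport g) : Integrable fun q => f q * g q :=
  (continuous_mul_of_tsupport_subset hU hf hg hgU).integrable_of_hasCompactSupport hgc.mul_left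

theorem tsupport_fderiv_apply_subset' (ψ : Plane → ℝ) (v : Plane) :
    tsupport (fun q => fderiv ℝ ψ q v) ⊆ tsupport ψ := tsupport_fderiv_apply_subset ℝ v

theorem integral_mul_fderiv_eq {U : Set Plane} (hU : IsOpen U) {f g : Plane → ℝ}
    (hf : ContDiffOn ℝ 1 f U) (hg : ContDiff ℝ 1 g) (hgU : tsupport g ⊆ U)
    (hgc : HasCompactSupport g) (v : Plane) :
    Integrable (fun q => fderiv ℝ f q v * g q) ∧
    Integrable (fun q => f q * fderiv ℝ g q v) ∧
    ∫ q, f q * fderiv ℝ g q v = - ∫ q, fderiv ℝ f q v * g q := by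
  have h1 : ContinuousOn (fun q => fderiv ℝ f q v) U :=
    (hf.continuousOn_fderiv_of_isOpen hU le_rfl).clm_apply continuousOn_const
  have h2 : Continuous (fun q => fderiv ℝ g q v) :=
    (hg.continuous_fderiv one_ne_zero).clm_apply continuous_const
  have i1 := integrable_mul_of_tsupport_subset hU h1 hg.continuous hgU hgc
  have i2 := integrable_mul_of_tsupport_subset hU hf.continuousOn h2
    ((tsupport_fderiv_apply_subset' g v).trans hgU) (hgc.fderiv_apply ℝ v)
  have i3 := integrable_mul_of_tsupport_subset hU hf.continuousOn hg.continuous hgU hgc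
  refine ⟨i1, i2, integral_mul_fderiv_eq_neg_fderiv_mul_of_integrable i1 i2 i3 ?_ ?_⟩
  · exact fun x hx => (hf.contDiffAt (hU.mem_nhds (hgU hx))).differentiableAt one_ne_zero
  · exact fun x _ => hg.differentiable one_ne_zero x

/-- If `χ` increases in the direction `e` at a rate comparable with the norm of its gradient,
then the flux of `F` against `χ` is controlled by the flux of any majorant of `‖F‖` in the
direction `e`. -/
theorem integral_mul_divergence_le {U : Set Plane} (hU : IsOpen U) {χ ψ : Plane → ℝ}
    {F : Plane → Plane} {e : Plane} {K : ℝ}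
    (hχ : ContDiffOn ℝ 1 χ U) (hK : ∀ q ∈ U, ‖fderiv ℝ χ q‖ ≤ K * fderiv ℝ χ q e)
    (hF : ContDiff ℝ 1 F) (hFc : HasCompactSupport F) (hFU : tsupport F ⊆ U)
    (hψ : ContDiff ℝ 1 ψ) (hψc : HasCompactSupport ψ) (hψU : tsupport ψ ⊆ U)
    (hFψ : ∀ q, ‖F q‖ ≤ ψ q) :
    ∫ q, χ q * divergence F q ≤ K * -∫ q, χ q * fderiv ℝ ψ q e := by
  have hFi : ∀ i, ContDiff ℝ 1 fun q => F q i := fun i => by fun_prop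
  have hsub : ∀ i, tsupport (fun q => F q i) ⊆ tsupport F := fun i => by
    refine closure_mono fun q hq => ?_
    intro h; apply hq; simp [h]
  have hFic : ∀ i, HasCompactSupport fun q => F q i := fun i =>
    hFc.of_isClosed_subset (isClosed_tsupport _) (hsub i)
  obtain ⟨a0, b0, c0⟩ := integral_mul_fderiv_eq hU hχ (hFi 0) ((hsub 0).trans hFU) (hFic 0)
    (EuclideanSpace.single 0 1)
  obtain ⟨a1, b1, c1⟩ := integral_mul_fderiv_eq hU hχ (hFi 1) ((hsub 1).trans hFU) (hFic 1)
    (EuclideanSpace.single 1 1)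
  obtain ⟨a2, b2, c2⟩ := integral_mul_fderiv_eq hU hχ hψ hψU hψc e
  have hdiff := hF.differentiable one_ne_zero
  have e1 : ∫ q, χ q * divergence F q
      = - ∫ q, (fderiv ℝ χ q (EuclideanSpace.single 0 1) * F q 0
        + fderiv ℝ χ q (EuclideanSpace.single 1 1) * F q 1) := by
    rw [integral_add a0 a1, neg_add, ← c0, ← c1, ← integral_add b0 b1]
    congr 1; ext q
    rw [fderiv_coord (hdiff q), fderiv_coord (hdiff q), divergence]; ring
  rw [e1, c2, neg_neg, ← integral_neg, ← integral_const_mul]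
  refine integral_mono (a0.add a1).neg (a2.const_mul K) fun q => ?_
  have e2 : fderiv ℝ χ q (EuclideanSpace.single 0 1) * F q 0
        + fderiv ℝ χ q (EuclideanSpace.single 1 1) * F q 1 = fderiv ℝ χ q (F q) := by
    conv_rhs => rw [eq_sum_coord (F q)]
    rw [map_add, map_smul, map_smul]; simp; ring
  have hψ0 : 0 ≤ ψ q := (norm_nonneg _).trans (hFψ q)
  simp only
  rw [e2]
  by_cases hq : q ∈ U
  · calc -(fderiv ℝ χ q (F q)) ≤ ‖fderiv ℝ χ q (F q)‖ := neg_le_abs _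
      _ ≤ ‖fderiv ℝ χ q‖ * ‖F q‖ := (fderiv ℝ χ q).le_opNorm _
      _ ≤ (K * fderiv ℝ χ q e) * ψ q :=
        mul_le_mul (hK q hq) (hFψ q) (norm_nonneg _) ((norm_nonneg _).trans (hK q hq))
      _ = _ := by ring
  · have : ψ q = 0 := image_eq_zero_of_notMem_tsupport fun h => hq (hψU h)
    have h2 : F q = 0 := image_eq_zero_of_notMem_tsupport fun h => hq (hFU h)
    simp [this, h2]

/-- The cut-offs are zero where `φ ≤ 0` and one as soon as `n φ ≥ 1`, so they converge everywhere to
the indicator of `φ > 0`, dominated by `‖g‖`. No null-set argument for `φ = 0` is needed. -/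
theorem tendsto_integral_smoothTransition {U : Set Plane} (hU : IsOpen U) {φ g : Plane → ℝ}
    (hφ : ContinuousOn φ U) (hg : Continuous g) (hgc : HasCompactSupport g)
    (hgU : tsupport g ⊆ U) :
    Tendsto (fun n : ℕ => ∫ q, Real.smoothTransition (n * φ q) * g q) atTop
      (𝓝 (∫ q in {q ∈ U | 0 < φ q}, g q)) := by
  have hms : MeasurableSet {q ∈ U | 0 < φ q} :=
    (hφ.isOpen_inter_preimage hU isOpen_Ioi).measurableSet
  rw [← integral_indicator hms]
  refine tendsto_integral_of_dominated_convergence (fun q => ‖g q‖) (fun n => ?_)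
    (hg.norm.integrable_of_hasCompactSupport hgc.norm) (fun n => ?_) ?_
  · refine (continuous_mul_of_tsupport_subset hU ?_ hg hgU).aestronglyMeasurable
    exact Real.smoothTransition.continuous.comp_continuousOn (continuousOn_const.mul hφ)
  · filter_upwards with q
    rw [norm_mul]
    refine mul_le_of_le_one_left (norm_nonneg _) ?_
    rw [Real.norm_of_nonneg (Real.smoothTransition.nonneg _)]
    exact Real.smoothTransition.le_one _
  · filter_upwards with q
    by_cases hq : q ∈ U
    · rcases lt_or_ge 0 (φ q) with h | h
      · rw [indicator_of_mem (show q ∈ {q ∈ U | 0 < φ q} from ⟨hq, h⟩)]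
        refine tendsto_const_nhds.congr' ?_
        obtain ⟨N, hN⟩ := exists_nat_gt (1 / φ q)
        filter_upwards [eventually_ge_atTop N] with n hn
        rw [Real.smoothTransition.one_of_one_le, one_mul]
        have : (N : ℝ) ≤ n := by exact_mod_cast hn
        rw [div_lt_iff₀ h] at hN
        nlinarith
      · rw [indicator_of_notMem (fun h' => absurd h'.2 (not_lt.2 h))]
        refine tendsto_const_nhds.congr fun n => ?_
        rw [Real.smoothTransition.zero_of_nonpos, zero_mul]
        exact mul_nonpos_of_nonneg_of_nonpos (Nat.cast_nonneg n) h
    · have : g q = 0 := image_eq_zero_of_notMem_tsupport fun h => hq (hgU h)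
      rw [indicator_of_notMem (fun h' => hq h'.1)]
      simp [this]

/-- Apply `integral_mul_divergence_le` to the smooth cut-offs of `n φ`. Composing with an increasing
function multiplies both sides of `hK` by the same nonnegative factor, so `K` does not depend on `n`
and the limit can be taken. -/
theorem setIntegral_divergence_le {U : Set Plane} (hU : IsOpen U) {φ ψ : Plane → ℝ}
    {F : Plane → Plane} {e : Plane} {K : ℝ}
    (hφ : ContDiffOn ℝ 1 φ U) (hK : ∀ q ∈ U, ‖fderiv ℝ φ q‖ ≤ K * fderiv ℝ φ q e)
    (hF : ContDiff ℝ 1 F) (hFc : HasCompactSupport F) (hFU : tsupport F ⊆ U)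
    (hψ : ContDiff ℝ 1 ψ) (hψc : HasCompactSupport ψ) (hψU : tsupport ψ ⊆ U)
    (hFψ : ∀ q, ‖F q‖ ≤ ψ q) :
    ∫ q in {q ∈ U | 0 < φ q}, divergence F q
      ≤ K * -∫ q in {q ∈ U | 0 < φ q}, fderiv ℝ ψ q e := by
  have h1 := tendsto_integral_smoothTransition hU hφ.continuousOn (continuous_divergence hF)
    (hFc.of_isClosed_subset (isClosed_tsupport _) (tsupport_divergence_subset F))
    ((tsupport_divergence_subset F).trans hFU)
  have h2 := tendsto_integral_smoothTransition hU hφ.continuousOn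
    ((hψ.continuous_fderiv one_ne_zero).clm_apply (continuous_const (y := e)))
    (hψc.fderiv_apply ℝ e) ((tsupport_fderiv_apply_subset' ψ e).trans hψU)
  refine le_of_tendsto_of_tendsto' h1 (h2.neg.const_mul K) fun n => ?_
  have hst : ContDiff ℝ 1 Real.smoothTransition := Real.smoothTransition.contDiff (n := 1)
  refine integral_mul_divergence_le hU (e := e) (K := K)
    (hst.comp_contDiffOn (contDiffOn_const.mul hφ)) (fun q hq => ?_) hF hFc hFU hψ hψc hψU hFψ
  have hd : HasFDerivAt (fun q => Real.smoothTransition (n * φ q))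
      (deriv Real.smoothTransition (n * φ q) • (n : ℝ) • fderiv ℝ φ q) q := by
    have hφq := ((hφ.contDiffAt (hU.mem_nhds hq)).differentiableAt one_ne_zero).hasFDerivAt
    exact ((hst.differentiable one_ne_zero _).hasDerivAt).comp_hasFDerivAt q
      (hφq.const_mul (n : ℝ))
  have hmono : 0 ≤ deriv Real.smoothTransition (n * φ q) :=
    Real.smoothTransition.monotone.deriv_nonneg
  rw [hd.fderiv, norm_smul, norm_smul, Real.norm_of_nonneg hmono, RCLike.norm_natCast]
  simp only [smul_apply, smul_eq_mul]
  calc _ ≤ deriv Real.smoothTransition (n * φ q) * (n * (K * fderiv ℝ φ q e)) := by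
        gcongr; exact hK q hq
    _ = _ := by ring

end

/-! ### Integration in an orthonormal frame -/

section

/-- The point with coordinates `z` in the orthonormal frame `b` centred at `p`. -/
def frame (p : Plane) (b : OrthonormalBasis (Fin 2) ℝ Plane) (z : ℝ × ℝ) : Plane :=
  p + (z.1 • b 0 + z.2 • b 1)

/-- The open square of half side `r` centred at `p` with sides parallel to the frame `b`. -/
def box (p : Plane) (b : OrthonormalBasis (Fin 2) ℝ Plane) (r : ℝ) : Set Plane :=
  {q | |inner ℝ (b 0) (q - p)| < r ∧ |inner ℝ (b 1) (q - p)| < r}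

variable {p : Plane} {b : OrthonormalBasis (Fin 2) ℝ Plane} {r : ℝ}

theorem inner_frame_zero (z : ℝ × ℝ) : inner ℝ (b 0) (frame p b z - p) = z.1 := by
  simp [frame, inner_add_right, inner_smul_right]

theorem inner_frame_one (z : ℝ × ℝ) : inner ℝ (b 1) (frame p b z - p) = z.2 := by
  simp [frame, inner_add_right, inner_smul_right]

theorem frame_inner (q : Plane) :
    frame p b (inner ℝ (b 0) (q - p), inner ℝ (b 1) (q - p)) = q := by
  have h := b.sum_repr' (q - p)
  simp only [Fin.sum_univ_two] at h
  simp [frame, h]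

theorem frame_mem_box {z : ℝ × ℝ} : frame p b z ∈ box p b r ↔ |z.1| < r ∧ |z.2| < r := by
  simp [box, inner_frame_zero, inner_frame_one]

theorem isOpen_box : IsOpen (box p b r) := by
  have h0 : Continuous fun q : Plane => |inner ℝ (b 0) (q - p)| := by fun_prop
  have h1 : Continuous fun q : Plane => |inner ℝ (b 1) (q - p)| := by fun_prop
  exact (isOpen_lt h0 continuous_const).inter (isOpen_lt h1 continuous_const)

theorem continuous_frame : Continuous (frame p b) := by
  unfold frame; fun_prop

variable (p b) in
/-- The frame coordinates as a measurable equivalence. -/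
def frameEquiv : ℝ × ℝ ≃ᵐ Plane where
  toFun := frame p b
  invFun q := (inner ℝ (b 0) (q - p), inner ℝ (b 1) (q - p))
  left_inv z := by simp [inner_frame_zero, inner_frame_one]
  right_inv q := frame_inner q
  measurable_toFun := continuous_frame.measurable
  measurable_invFun := by
    change Measurable fun q : Plane => ((inner ℝ (b 0) (q - p) : ℝ), (inner ℝ (b 1) (q - p) : ℝ))
    exact Continuous.measurable (by fun_prop)

theorem measurePreserving_frameEquiv : MeasurePreserving (frameEquiv p b) := by
  have h1 : MeasurePreserving (MeasurableEquiv.finTwoArrow (α := ℝ)).symm :=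
    (volume_preserving_finTwoArrow ℝ).symm
  have h2 : MeasurePreserving (MeasurableEquiv.toLp 2 (Fin 2 → ℝ)) :=
    (EuclideanSpace.volume_preserving_symm_measurableEquiv_toLp (Fin 2)).symm
  have h3 := b.measurePreserving_repr_symm
  have h4 : MeasurePreserving (fun q : Plane => p + q) := measurePreserving_add_left volume p
  have h := h4.comp (h3.comp (h2.comp h1))
  convert h using 1
  ext1 z
  simp only [Function.comp]
  change frame p b z = _
  rw [← OrthonormalBasis.sum_repr_symm]
  simp [frame, Fin.sum_univ_two, MeasurableEquiv.finTwoArrow]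

/-- Orthogonal projection to the first axis of the frame is 1-Lipschitz and so does not increase
one-dimensional Hausdorff measure. This replaces the arc length formula for a graph. -/
theorem volume_le_hausdorffMeasure_of_projection {Z : Set Plane} {V : Set ℝ}
    (hZ : ∀ x ∈ V, ∃ q ∈ Z, inner ℝ (b 0) (q - p) = x) {h : Plane → ℝ≥0∞} {γ : ℝ → Plane}
    (hγ : ∀ q ∈ Z, γ (inner ℝ (b 0) (q - p)) = q) (hZm : MeasurableSet Z) :
    ∫⁻ x in V, h (γ x) ≤ ∫⁻ q in Z, h q ∂μH[1] := by
  set P : Plane → ℝ := fun q => inner ℝ (b 0) (q - p) with hP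
  have hPc : Continuous P := by fun_prop
  have hlip : LipschitzWith 1 P := by
    refine LipschitzWith.of_dist_le_mul fun q q' => ?_
    have : P q - P q' = inner ℝ (b 0) (q - q') := by
      simp only [hP, ← inner_sub_right]; congr 1; abel
    rw [Real.dist_eq, this, dist_eq_norm, NNReal.coe_one]
    refine (abs_real_inner_le_norm _ _).trans ?_
    simp
  have hle : volume.restrict V ≤ Measure.map P ((μH[1] : Measure Plane).restrict Z) := by
    refine Measure.le_iff.2 fun A hA => ?_
    rw [Measure.map_apply hPc.measurable hA, Measure.restrict_apply hA,
      Measure.restrict_apply (hPc.measurable hA), ← hausdorffMeasure_real]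
    calc μH[1] (A ∩ V) ≤ μH[1] (P '' (P ⁻¹' A ∩ Z)) := by
          refine measure_mono fun x hx => ?_
          obtain ⟨q, hq, rfl⟩ := hZ x hx.2
          exact ⟨q, ⟨hx.1, hq⟩, rfl⟩
      _ ≤ _ := by
          simpa using hlip.hausdorffMeasure_image_le zero_le_one (P ⁻¹' A ∩ Z)
  calc ∫⁻ x in V, h (γ x) ≤ ∫⁻ x, h (γ x) ∂(Measure.map P ((μH[1] : Measure Plane).restrict Z)) :=
        lintegral_mono' hle le_rfl
    -- No measurability of `h` or `γ` is assumed; the one-sided change of variables does not need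
    -- it.
    _ ≤ ∫⁻ q in Z, h (γ (P q)) ∂μH[1] := lintegral_map_le _ _
    _ = _ := setLIntegral_congr_fun hZm fun q hq => by simp only [hγ q hq, hP]

theorem hasDerivAt_comp_frame {ψ : Plane → ℝ} {x y : ℝ}
    (hψ : DifferentiableAt ℝ ψ (frame p b (x, y))) :
    HasDerivAt (fun y => ψ (frame p b (x, y))) (fderiv ℝ ψ (frame p b (x, y)) (b 1)) y := by
  have h1 : HasDerivAt (fun y : ℝ => frame p b (x, y)) (b 1) y := by
    have := (((hasDerivAt_id y).smul_const (b 1)).const_add (x • b 0)).const_add p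
    simpa [frame] using this
  exact hψ.hasFDerivAt.comp_hasDerivAt y h1

theorem measurableSet_zeros {U : Set Plane} (hU : IsOpen U) {φ : Plane → ℝ}
    (hφ : ContinuousOn φ U) : MeasurableSet {q ∈ U | φ q = 0} := by
  have h1 := (hφ.isOpen_inter_preimage hU (isOpen_compl_singleton (x := (0 : ℝ)))).measurableSet
  have : {q ∈ U | φ q = 0} = U \ (U ∩ φ ⁻¹' {0}ᶜ) := by
    ext q
    simp only [mem_ofPred_eq, Set.mem_sdiff, mem_inter_iff, mem_preimage, mem_compl_iff,
      mem_singleton_iff]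
    tauto
  rw [this]
  exact hU.measurableSet.diff h1

/-- Fubini in the frame: on the vertical line over `x` the set `φ > 0` is the interval from the zero
`g x` to `r`, and `ψ` vanishes at the top, so the slice integral is the value of `ψ` on the zero
set. Projecting the zero set to the axis concludes. -/
theorem neg_setIntegral_fderiv_le_lintegral_hausdorff {φ ψ : Plane → ℝ}
    (hφ : ContinuousOn φ (box p b r))
    (hmono : ∀ x, |x| < r → StrictMonoOn (fun y => φ (frame p b (x, y))) (Ioo (-r) r))
    (hzero : ∀ x, |x| < r → ∃ y ∈ Ioo (-r) r, φ (frame p b (x, y)) = 0)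
    (hψ : ContDiff ℝ 1 ψ) (hψc : HasCompactSupport ψ) (hψU : tsupport ψ ⊆ box p b r)
    (hψ0 : ∀ q, 0 ≤ ψ q) :
    ENNReal.ofReal (-∫ q in {q ∈ box p b r | 0 < φ q}, fderiv ℝ ψ q (b 1))
      ≤ ∫⁻ q in {q ∈ box p b r | φ q = 0}, ENNReal.ofReal (ψ q) ∂μH[1] := by
  have hms : MeasurableSet {q ∈ box p b r | 0 < φ q} :=
    (hφ.isOpen_inter_preimage isOpen_box isOpen_Ioi).measurableSet
  have hms0 : MeasurableSet {q ∈ box p b r | φ q = 0} := measurableSet_zeros isOpen_box hφ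
  have hdc : Continuous fun q => fderiv ℝ ψ q (b 1) :=
    (hψ.continuous_fderiv one_ne_zero).clm_apply continuous_const
  choose! g hgmem hg0 using hzero
  set k : Plane → ℝ := indicator {q ∈ box p b r | 0 < φ q} fun q => -fderiv ℝ ψ q (b 1) with hk
  have hkint : Integrable k :=
    ((hdc.integrable_of_hasCompactSupport (hψc.fderiv_apply ℝ (b 1))).neg).indicator hms
  have hkint' : Integrable (fun z => k (frameEquiv p b z)) :=
    (measurePreserving_frameEquiv.integrable_comp_emb (frameEquiv p b).measurableEmbedding).2 hkint
  have hslice : ∀ x, ∫ y, k (frameEquiv p b (x, y))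
      = indicator (Ioo (-r) r) (fun x => ψ (frame p b (x, g x))) x := by
    intro x
    by_cases hx : |x| < r
    · rw [indicator_of_mem (show x ∈ Ioo (-r) r from abs_lt.1 hx)]
      have hgx := hgmem x hx
      have e1 : (fun y => k (frameEquiv p b (x, y)))
          = indicator (Ioo (g x) r) fun y => -fderiv ℝ ψ (frame p b (x, y)) (b 1) := by
        ext y
        change k (frame p b (x, y)) = _
        have hiff : frame p b (x, y) ∈ {q ∈ box p b r | 0 < φ q} ↔ y ∈ Ioo (g x) r := ?_
        · by_cases hy : y ∈ Ioo (g x) r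
          · rw [hk, indicator_of_mem hy, indicator_of_mem (hiff.2 hy)]
          · rw [hk, indicator_of_notMem hy, indicator_of_notMem (fun h => hy (hiff.1 h))]
        simp only [mem_ofPred_eq, frame_mem_box, hx, true_and, mem_Ioo]
        constructor
        · rintro ⟨h1, h2⟩
          refine ⟨?_, (abs_lt.1 h1).2⟩
          rw [← hg0 x hx] at h2
          exact ((hmono x hx).lt_iff_lt hgx (abs_lt.1 h1)).1 h2
        · rintro ⟨h1, h2⟩
          have hy : y ∈ Ioo (-r) r := ⟨hgx.1.trans h1, h2⟩
          refine ⟨abs_lt.2 hy, ?_⟩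
          rw [← hg0 x hx]
          exact (hmono x hx) hgx hy h1
      rw [e1, integral_indicator measurableSet_Ioo, ← integral_Ioc_eq_integral_Ioo,
        ← intervalIntegral.integral_of_le hgx.2.le, intervalIntegral.integral_neg,
        intervalIntegral.integral_eq_sub_of_hasDerivAt
          (fun y _ => hasDerivAt_comp_frame (hψ.differentiable one_ne_zero _))]
      · have : ψ (frame p b (x, r)) = 0 := by
          refine image_eq_zero_of_notMem_tsupport fun h => ?_
          have := (frame_mem_box.1 (hψU h)).2
          exact absurd (le_abs_self r) (not_le.2 this)
        rw [this]; ring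
      · refine Continuous.intervalIntegrable ?_ _ _
        exact hdc.comp (continuous_frame.comp (by fun_prop))
    · rw [indicator_of_notMem (show x ∉ Ioo (-r) r from fun h => hx (abs_lt.2 h))]
      rw [← integral_zero ℝ ℝ]
      congr 1; ext y
      change k (frame p b (x, y)) = _
      rw [hk, indicator_of_notMem]
      rintro ⟨h, -⟩
      exact hx (frame_mem_box.1 h).1
  have e2 : -∫ q in {q ∈ box p b r | 0 < φ q}, fderiv ℝ ψ q (b 1)
      = ∫ x, indicator (Ioo (-r) r) (fun x => ψ (frame p b (x, g x))) x := by
    rw [← integral_neg, ← integral_indicator hms]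
    rw [← measurePreserving_frameEquiv.integral_comp' (f := frameEquiv p b) k]
    rw [Measure.volume_eq_prod, integral_prod _ hkint']
    simp_rw [hslice]
  -- Nothing is known about the regularity of `g`; integrability comes from Fubini, since this
  -- function is a slice integral.
  have hintegrable : Integrable (indicator (Ioo (-r) r) (fun x => ψ (frame p b (x, g x)))) := by
    have := hkint'
    rw [Measure.volume_eq_prod] at this
    have := this.integral_prod_left
    simpa only [hslice] using this
  rw [e2, ofReal_integral_eq_lintegral_ofReal hintegrable
    (Eventually.of_forall fun x => indicator_nonneg (fun x _ => hψ0 _) x)]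
  have e3 : ∀ x, ENNReal.ofReal (indicator (Ioo (-r) r) (fun x => ψ (frame p b (x, g x))) x)
      = indicator (Ioo (-r) r) (fun x => ENNReal.ofReal (ψ (frame p b (x, g x)))) x := by
    intro x
    by_cases hx : x ∈ Ioo (-r) r <;> simp [hx]
  simp_rw [e3]
  rw [lintegral_indicator measurableSet_Ioo]
  refine volume_le_hausdorffMeasure_of_projection (p := p) (b := b)
    (h := fun q => ENNReal.ofReal (ψ q)) (γ := fun x => frame p b (x, g x))
    (fun x hx => ?_) (fun q hq => ?_) hms0
  · have hx' := abs_lt.2 hx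
    exact ⟨frame p b (x, g x), ⟨frame_mem_box.2 ⟨hx', abs_lt.2 (hgmem x hx')⟩, hg0 x hx'⟩,
      inner_frame_zero _⟩
  · obtain ⟨⟨h1, h2⟩, h3⟩ := hq
    conv_rhs => rw [← frame_inner (p := p) (b := b) q]
    congr 2
    refine (hmono _ h1).injOn (hgmem _ h1) (abs_lt.1 h2) ?_
    rw [frame_inner, hg0 _ h1, h3]

end

/-! ### Local bounds for the flux -/

section

variable {p : Plane} {b : OrthonormalBasis (Fin 2) ℝ Plane} {r : ℝ}

/-- In the square `box p b r` the zero set of `φ` is a graph over the first axis of the frame `b`,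
nearly parallel to this axis, and `φ` is positive above and negative below it. -/
structure IsFlatBox (φ : Plane → ℝ) (p : Plane) (b : OrthonormalBasis (Fin 2) ℝ Plane)
    (r K : ℝ) : Prop where
  pos : 0 < r
  contDiffOn : ContDiffOn ℝ 1 φ (box p b r)
  norm_fderiv_le : ∀ q ∈ box p b r, ‖fderiv ℝ φ q‖ ≤ K * fderiv ℝ φ q (b 1)
  strictMonoOn : ∀ x, |x| < r → StrictMonoOn (fun y => φ (frame p b (x, y))) (Ioo (-r) r)
  pos_top : ∀ x, |x| < r → 0 < φ (frame p b (x, 3 * r / 4))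
  neg_bot : ∀ x, |x| < r → φ (frame p b (x, -(3 * r / 4))) < 0

/-- The second frame vector is the normalized gradient representing `L`. -/
theorem exists_frame_fderiv {L : Plane →L[ℝ] ℝ} (hL : L ≠ 0) :
    ∃ b : OrthonormalBasis (Fin 2) ℝ Plane, L (b 0) = 0 ∧ L (b 1) = ‖L‖ := by
  obtain ⟨w, hw⟩ := (InnerProductSpace.toDual ℝ Plane).surjective L
  have hwL : ∀ v, L v = inner ℝ w v := fun v => by rw [← hw]; rfl
  have hnorm : ‖w‖ = ‖L‖ := by rw [← hw, LinearIsometryEquiv.norm_map]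
  have hw0 : ‖w‖ ≠ 0 := by rw [hnorm]; exact norm_ne_zero_iff.2 hL
  have hon : Orthonormal ℝ (({1} : Set (Fin 2)).domRestrict fun _ => ‖w‖⁻¹ • w) := by
    constructor
    · intro i; simp [norm_smul, hw0]
    · intro i j hij
      exact absurd (Subsingleton.elim i j) hij
  obtain ⟨b, hb⟩ := hon.exists_orthonormalBasis_extension_of_card_eq (by simp)
  have hb1 : b 1 = ‖w‖⁻¹ • w := hb 1 rfl
  have hwb : w = ‖w‖ • b 1 := by rw [hb1, smul_smul, mul_inv_cancel₀ hw0, one_smul]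
  refine ⟨b, ?_, ?_⟩
  · rw [hwL, hwb, inner_smul_left]; simp
  · rw [hwL, ← hnorm]
    conv_lhs => rw [hwb, inner_smul_left]
    simp

theorem frame_zero : frame p b (0, 0) = p := by simp [frame]

/-- In the frame adapted to the gradient at `p`, continuity gives `‖dφ‖ < K ∂₁φ` and `2 |∂₀φ| < ∂₁φ`
nearby. By the second bound the zero set has slope below one half, so over `|x| < r` it stays within
height `r / 2`, and the levels `±3 r / 4` lie strictly on either side of it. -/
theorem exists_isFlatBox {φ : Plane → ℝ} {U : Set Plane} (hU : IsOpen U) (hpU : p ∈ U)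
    (hφ : ContDiffOn ℝ 1 φ U) (h0 : φ p = 0) (hd : fderiv ℝ φ p ≠ 0) {K : ℝ} (hK : 1 < K) :
    ∃ b r, box p b r ⊆ U ∧ IsFlatBox φ p b r K := by
  obtain ⟨b, hb0, hb1⟩ := exists_frame_fderiv hd
  have hpos : 0 < ‖fderiv ℝ φ p‖ := norm_pos_iff.2 hd
  have hc : ContinuousAt (fderiv ℝ φ) p :=
    (hφ.continuousOn_fderiv_of_isOpen hU le_rfl).continuousAt (hU.mem_nhds hpU)
  have ev1 : ∀ᶠ q in 𝓝 p, ‖fderiv ℝ φ q‖ < K * fderiv ℝ φ q (b 1) := by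
    refine (hc.norm).eventually_lt
      (continuousAt_const.mul (hc.clm_apply continuousAt_const)) ?_
    rw [hb1]; nlinarith
  have ev2 : ∀ᶠ q in 𝓝 p, 2 * |fderiv ℝ φ q (b 0)| < fderiv ℝ φ q (b 1) := by
    refine (continuousAt_const.mul (hc.clm_apply continuousAt_const).abs).eventually_lt
      (hc.clm_apply continuousAt_const) ?_
    change 2 * |fderiv ℝ φ p (b 0)| < fderiv ℝ φ p (b 1)
    rw [hb1, hb0]; simpa using hpos
  obtain ⟨ρ, hρ, hball⟩ := Metric.eventually_nhds_iff_ball.1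
    ((ev1.and ev2).and (hU.mem_nhds hpU))
  have hbox : box p b (ρ / 2) ⊆ Metric.ball p ρ := by
    intro q hq
    rw [mem_ball_iff_norm]
    have h1 := b.sum_repr' (q - p)
    rw [Fin.sum_univ_two] at h1
    rw [← h1]
    refine (norm_add_le _ _).trans_lt ?_
    rw [norm_smul, norm_smul, b.norm_eq_one, b.norm_eq_one, mul_one, mul_one]
    have := hq.1; have := hq.2
    simp only [Real.norm_eq_abs]
    linarith
  have hdiff : ∀ q ∈ box p b (ρ / 2), DifferentiableAt ℝ φ q := fun q hq =>
    (hφ.contDiffAt (hU.mem_nhds (hball q (hbox hq)).2)).differentiableAt one_ne_zero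
  have hr : 0 < ρ / 2 := by positivity
  have hder : ∀ q ∈ box p b (ρ / 2), 0 < fderiv ℝ φ q (b 1) := fun q hq =>
    lt_of_le_of_lt (by positivity) (hball q (hbox hq)).1.2
  -- Since `φ p = 0`, the sign of `φ` at a point follows from the sign of its derivative along the
  -- segment from `p`; `c = ±1` covers both signs.
  have hray : ∀ c x y : ℝ, |x| < ρ / 2 → |y| < ρ / 2 →
      (∀ q ∈ box p b (ρ / 2), 0 < c * fderiv ℝ φ q (x • b 0 + y • b 1)) →
      0 < c * φ (frame p b (x, y)) := by
    intro c x y hx hy hpos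
    have hmem : ∀ s ∈ Icc (0 : ℝ) 1, frame p b (s * x, s * y) ∈ box p b (ρ / 2) := by
      intro s hs
      rw [frame_mem_box]
      simp only [abs_mul, abs_of_nonneg hs.1]
      constructor
      · exact (mul_le_of_le_one_left (abs_nonneg _) hs.2).trans_lt hx
      · exact (mul_le_of_le_one_left (abs_nonneg _) hs.2).trans_lt hy
    have hd1 : ∀ s ∈ Icc (0 : ℝ) 1, HasDerivAt (fun s : ℝ => c * φ (frame p b (s * x, s * y)))
        (c * fderiv ℝ φ (frame p b (s * x, s * y)) (x • b 0 + y • b 1)) s := by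
      intro s hs
      have h1 : HasDerivAt (fun s : ℝ => frame p b (s * x, s * y)) (x • b 0 + y • b 1) s := by
        have := ((hasDerivAt_id s).smul_const (x • b 0 + y • b 1)).const_add p
        simpa [frame, mul_smul, smul_add] using this
      exact ((hdiff _ (hmem s hs)).hasFDerivAt.comp_hasDerivAt s h1).const_mul c
    have hm : StrictMonoOn (fun s : ℝ => c * φ (frame p b (s * x, s * y))) (Icc 0 1) := by
      refine strictMonoOn_of_deriv_pos (convex_Icc 0 1)
        (fun s hs => (hd1 s hs).continuousAt.continuousWithinAt) fun s hs => ?_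
      rw [interior_Icc] at hs
      have hs' := Ioo_subset_Icc_self hs
      rw [(hd1 s hs').deriv]
      exact hpos _ (hmem s hs')
    have := hm (left_mem_Icc.2 zero_le_one) (right_mem_Icc.2 zero_le_one) zero_lt_one
    simpa [frame_zero, h0] using this
  refine ⟨b, ρ / 2, fun q hq => (hball q (hbox hq)).2, hr,
    hφ.mono fun q hq => (hball q (hbox hq)).2, fun q hq => (hball q (hbox hq)).1.1.le,
    fun x hx => ?_, fun x hx => ?_, fun x hx => ?_⟩
  · have hd1 : ∀ y ∈ Ioo (-(ρ / 2)) (ρ / 2), HasDerivAt (fun y => φ (frame p b (x, y)))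
        (fderiv ℝ φ (frame p b (x, y)) (b 1)) y := fun y hy =>
      hasDerivAt_comp_frame (hdiff _ (frame_mem_box.2 ⟨hx, abs_lt.2 hy⟩))
    refine strictMonoOn_of_deriv_pos (convex_Ioo _ _)
      (fun y hy => (hd1 y hy).continuousAt.continuousWithinAt) fun y hy => ?_
    rw [interior_Ioo] at hy
    rw [(hd1 y hy).deriv]
    exact hder _ (frame_mem_box.2 ⟨hx, abs_lt.2 hy⟩)
  · have h := hray 1 x (3 * (ρ / 2) / 4) hx (by rw [abs_of_pos] <;> linarith) fun q hq => ?_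
    · simpa using h
    have h1 := (hball q (hbox hq)).1.2
    have h2 := hder q hq
    rw [map_add, map_smul, map_smul, smul_eq_mul, smul_eq_mul]
    have h3 : |x * fderiv ℝ φ q (b 0)| ≤ ρ / 2 * (fderiv ℝ φ q (b 1) / 2) := by
      rw [abs_mul]
      exact mul_le_mul hx.le (by linarith) (abs_nonneg _) hr.le
    nlinarith [neg_abs_le (x * fderiv ℝ φ q (b 0))]
  · have h := hray (-1) x (-(3 * (ρ / 2) / 4)) hx (by rw [abs_neg, abs_of_pos] <;> linarith)
      fun q hq => ?_
    · simpa using h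
    have h1 := (hball q (hbox hq)).1.2
    have h2 := hder q hq
    rw [map_add, map_smul, map_smul, smul_eq_mul, smul_eq_mul]
    have h3 : |x * fderiv ℝ φ q (b 0)| ≤ ρ / 2 * (fderiv ℝ φ q (b 1) / 2) := by
      rw [abs_mul]
      exact mul_le_mul hx.le (by linarith) (abs_nonneg _) hr.le
    nlinarith [le_abs_self (x * fderiv ℝ φ q (b 0))]

namespace IsFlatBox

variable {φ : Plane → ℝ} {K : ℝ}

theorem abs_top_lt (h : IsFlatBox φ p b r K) : |3 * r / 4| < r := by
  have := h.pos
  rw [abs_of_pos] <;> linarith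

theorem exists_zero (h : IsFlatBox φ p b r K) (x : ℝ) (hx : |x| < r) :
    ∃ y ∈ Ioo (-r) r, φ (frame p b (x, y)) = 0 := by
  have hr := h.pos
  have hc : ContinuousOn (fun y => φ (frame p b (x, y))) (Icc (-(3 * r / 4)) (3 * r / 4)) := by
    refine h.contDiffOn.continuousOn.comp (continuous_frame.comp (by fun_prop)).continuousOn
      fun y hy => frame_mem_box.2 ⟨hx, ?_⟩
    rw [abs_lt]
    constructor <;> linarith [hy.1, hy.2]
  obtain ⟨y, hy, hy0⟩ := intermediate_value_Icc (by linarith) hc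
    ⟨(h.neg_bot x hx).le, (h.pos_top x hx).le⟩
  exact ⟨y, ⟨by linarith [hy.1], by linarith [hy.2]⟩, hy0⟩

/-- Every point is joined to a base point by a horizontal segment at height `3 r / 4` followed by a
vertical one. On the vertical segment `φ` is monotone and positive at both ends. -/
theorem isPreconnected_pos (h : IsFlatBox φ p b r K) :
    IsPreconnected {q ∈ box p b r | 0 < φ q} := by
  have hr := h.pos
  have hT := h.abs_top_lt
  refine isPreconnected_of_forall (frame p b (0, 3 * r / 4)) fun q hq => ?_
  obtain ⟨x, y, rfl⟩ : ∃ x y, frame p b (x, y) = q := ⟨_, _, frame_inner q⟩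
  obtain ⟨hq1, hq2⟩ := hq
  obtain ⟨hx, hy⟩ := frame_mem_box.1 hq1
  simp only at hx hy
  refine ⟨(fun t => frame p b (t, 3 * r / 4)) '' uIcc 0 x ∪
    (fun t => frame p b (x, t)) '' uIcc (3 * r / 4) y, ?_,
    Or.inl ⟨0, left_mem_uIcc, rfl⟩, Or.inr ⟨y, right_mem_uIcc, rfl⟩, ?_⟩
  · rintro _ (⟨t, ht, rfl⟩ | ⟨t, ht, rfl⟩)
    · have ht' : |t| < r := by
        refine lt_of_le_of_lt ?_ hx
        have := abs_sub_left_of_mem_uIcc ht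
        simpa using this
      exact ⟨frame_mem_box.2 ⟨ht', hT⟩, h.pos_top t ht'⟩
    · have hmem : t ∈ Ioo (-r) r := by
        exact (ordConnected_Ioo.uIcc_subset (abs_lt.1 hT) (abs_lt.1 hy)) ht
      refine ⟨frame_mem_box.2 ⟨hx, abs_lt.2 hmem⟩, ?_⟩
      have hm := (h.strictMonoOn x hx).monotoneOn
      rcases le_total (3 * r / 4) y with hle | hle
      · rw [uIcc_of_le hle] at ht
        exact (h.pos_top x hx).trans_le (hm (abs_lt.1 hT) hmem ht.1)
      · rw [uIcc_of_ge hle] at ht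
        exact hq2.trans_le (hm (abs_lt.1 hy) hmem ht.1)
  · refine IsPreconnected.union (frame p b (x, 3 * r / 4)) ⟨x, right_mem_uIcc, rfl⟩
      ⟨_, left_mem_uIcc, rfl⟩ ?_ ?_
    · exact isPreconnected_uIcc.image _
        (continuous_frame.comp (by fun_prop)).continuousOn
    · exact isPreconnected_uIcc.image _
        (continuous_frame.comp (by fun_prop)).continuousOn

/-- Each vertical line of the frame meets the zero set at most once. -/
theorem volume_zero (h : IsFlatBox φ p b r K) : volume {q ∈ box p b r | φ q = 0} = 0 := by
  have hms0 : MeasurableSet {q ∈ box p b r | φ q = 0} :=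
    measurableSet_zeros isOpen_box h.contDiffOn.continuousOn
  rw [← measurePreserving_frameEquiv.measure_preimage_equiv (f := frameEquiv p b),
    Measure.volume_eq_prod, Measure.measure_prod_null ((frameEquiv p b).measurable hms0)]
  filter_upwards with x
  refine Set.Subsingleton.measure_zero (fun y hy y' hy' => ?_) _
  obtain ⟨h1, h2⟩ := hy
  obtain ⟨h1', h2'⟩ := hy'
  have hb := frame_mem_box.1 h1
  have hb' := frame_mem_box.1 h1'
  exact (h.strictMonoOn x hb.1).injOn (abs_lt.1 hb.2) (abs_lt.1 hb'.2) (h2.trans h2'.symm)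

theorem ofReal_flux_le (h : IsFlatBox φ p b r K) (hK : 0 ≤ K) {F : Plane → Plane}
    {ψ : Plane → ℝ}
    (hF : ContDiff ℝ 1 F) (hFc : HasCompactSupport F) (hFU : tsupport F ⊆ box p b r)
    (hψ : ContDiff ℝ 1 ψ) (hψc : HasCompactSupport ψ) (hψU : tsupport ψ ⊆ box p b r)
    (hFψ : ∀ q, ‖F q‖ ≤ ψ q) :
    ENNReal.ofReal (∫ q in {q ∈ box p b r | 0 < φ q}, divergence F q)
      ≤ ENNReal.ofReal K * ∫⁻ q in {q ∈ box p b r | φ q = 0}, ENNReal.ofReal (ψ q) ∂μH[1] := by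
  refine (ENNReal.ofReal_le_ofReal (setIntegral_divergence_le isOpen_box h.contDiffOn
    h.norm_fderiv_le hF hFc hFU hψ hψc hψU hFψ)).trans ?_
  rw [ENNReal.ofReal_mul hK]
  gcongr
  exact neg_setIntegral_fderiv_le_lintegral_hausdorff h.contDiffOn.continuousOn h.strictMonoOn
    h.exists_zero hψ hψc hψU fun q => (norm_nonneg _).trans (hFψ q)

end IsFlatBox

theorem subset_or_disjoint_of_disjoint_frontier {X : Type*} [TopologicalSpace X] {s D : Set X}
    (hs : IsPreconnected s) (hD : IsOpen D) (h : Disjoint s (frontier D)) :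
    s ⊆ D ∨ Disjoint s D := by
  have hsub : s ⊆ D ∪ (closure D)ᶜ := by
    intro x hx
    by_contra hc
    rw [mem_union, not_or, notMem_compl_iff] at hc
    refine h.notMem_of_mem_left hx ?_
    rw [hD.frontier_eq]
    exact ⟨hc.2, hc.1⟩
  rcases hs.subset_or_subset hD isClosed_closure.isOpen_compl
    (disjoint_compl_right.mono_left subset_closure) hsub with h1 | h1
  · exact Or.inl h1
  · exact Or.inr ((disjoint_compl_left.mono_right subset_closure).mono_left h1)

theorem integral_divergence_eq_zero {F : Plane → Plane} (hF : ContDiff ℝ 1 F)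
    (hFc : HasCompactSupport F) : ∫ q, divergence F q = 0 := by
  have key : ∀ i : Fin 2, ∫ q, fderiv ℝ (fun q => F q i) q (EuclideanSpace.single i 1) = 0 ∧
      Integrable fun q => fderiv ℝ (fun q => F q i) q (EuclideanSpace.single i 1) := by
    intro i
    have hc : HasCompactSupport fun q => F q i :=
      hFc.comp_left (g := fun w : Plane => w i) rfl
    obtain ⟨-, h2, h3⟩ := integral_mul_fderiv_eq isOpen_univ (f := fun _ => (1 : ℝ))
      contDiffOn_const (show ContDiff ℝ 1 fun q => F q i by fun_prop) (subset_univ _) hc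
      (EuclideanSpace.single i 1)
    exact ⟨by simpa using h3, by simpa using h2⟩
  have : ∀ q, divergence F q = fderiv ℝ (fun q => F q 0) q (EuclideanSpace.single 0 1)
      + fderiv ℝ (fun q => F q 1) q (EuclideanSpace.single 1 1) := fun q => by
    rw [fderiv_coord (hF.differentiable one_ne_zero q),
      fderiv_coord (hF.differentiable one_ne_zero q), divergence]
  simp_rw [this]
  rw [integral_add (key 0).2 (key 1).2, (key 0).1, (key 1).1, add_zero]

/-- The integral of the divergence only depends on the domain inside the support. -/
theorem setIntegral_divergence_congr {F : Plane → Plane} {A B U : Set Plane}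
    (hA : MeasurableSet A) (hB : MeasurableSet B) (hFU : tsupport F ⊆ U)
    (hAB : ∀ᵐ q, q ∈ U → (q ∈ A ↔ q ∈ B)) :
    ∫ q in A, divergence F q = ∫ q in B, divergence F q := by
  rw [← integral_indicator hA, ← integral_indicator hB]
  refine integral_congr_ae ?_
  filter_upwards [hAB] with q hq
  by_cases hqU : q ∈ U
  · by_cases hqA : q ∈ A
    · rw [indicator_of_mem hqA, indicator_of_mem ((hq hqU).1 hqA)]
    · rw [indicator_of_notMem hqA, indicator_of_notMem fun h => hqA ((hq hqU).2 h)]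
  · have h0 : divergence F q = 0 := image_eq_zero_of_notMem_tsupport fun h =>
      hqU (hFU (tsupport_divergence_subset F h))
    simp [indicator, h0]

/-- The flux of `F` through the boundary of `D` is bounded by the integral of `ψ`, up to the factor
`K`, for all fields `F` supported in `U` and all majorants `ψ` of `‖F‖` supported in `U`. -/
def HasFluxBound (D U : Set Plane) (K : ℝ) : Prop :=
  ∀ (F : Plane → Plane) (ψ : Plane → ℝ), ContDiff ℝ 1 F → HasCompactSupport F → tsupport F ⊆ U →
    ContDiff ℝ 1 ψ → HasCompactSupport ψ → tsupport ψ ⊆ U → (∀ q, ‖F q‖ ≤ ψ q) →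
    ENNReal.ofReal (∫ q in D, divergence F q)
      ≤ ENNReal.ofReal K * ∫⁻ q in frontier D, ENNReal.ofReal (ψ q) ∂μH[1]

theorem hasFluxBound_of_ae_pos {D U V : Set Plane} (hD : IsOpen D) {φ : Plane → ℝ} {K : ℝ}
    (h : IsFlatBox φ p b r K) (hK : 0 ≤ K) (hV : V ⊆ box p b r) (hU : box p b r ⊆ U)
    (hφ : frontier D ∩ U = {q ∈ U | φ q = 0}) (hDV : ∀ q ∈ V, q ∈ D ↔ 0 < φ q) :
    HasFluxBound D V K := by
  intro F ψ hF hFc hFU hψ hψc hψU hFψ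
  have hms : MeasurableSet {q ∈ box p b r | 0 < φ q} :=
    (h.contDiffOn.continuousOn.isOpen_inter_preimage isOpen_box isOpen_Ioi).measurableSet
  rw [setIntegral_divergence_congr hD.measurableSet hms hFU
    (Eventually.of_forall fun q hq => (hDV q hq).trans ⟨fun h => ⟨hV hq, h⟩, fun h => h.2⟩)]
  refine (h.ofReal_flux_le hK hF hFc (hFU.trans hV) hψ hψc (hψU.trans hV) hFψ).trans ?_
  gcongr
  intro q hq
  have : q ∈ frontier D ∩ U := hφ ▸ ⟨hU hq.1, hq.2⟩
  exact this.1

/-- The flux is then zero, so any `K` works. This serves points off the boundary and also boundary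
arcs with `D` on both sides, which a smooth frontier does not exclude. -/
theorem hasFluxBound_of_ae {D V E : Set Plane} (hD : IsOpen D) {K : ℝ} (hE : E = univ ∨ E = ∅)
    (hDV : ∀ᵐ q, q ∈ V → (q ∈ D ↔ q ∈ E)) :
    HasFluxBound D V K := by
  intro F ψ hF hFc hFU hψ hψc hψU hFψ
  rcases hE with rfl | rfl
  · rw [setIntegral_divergence_congr hD.measurableSet MeasurableSet.univ hFU hDV]
    simp [integral_divergence_eq_zero hF hFc]
  · rw [setIntegral_divergence_congr hD.measurableSet MeasurableSet.empty hFU hDV]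
    simp

/-- Near a boundary point the sets `φ > 0` and `φ < 0` are connected in suitable squares and miss
the frontier, so each lies in `D` or is disjoint from it. Four cases remain. -/
theorem exists_hasFluxBound {D : Set Plane} (hD : IsOpen D) (hc : IsSmoothCurve (frontier D))
    {K : ℝ} (hK : 1 < K) (p : Plane) : ∃ V, IsOpen V ∧ p ∈ V ∧ HasFluxBound D V K := by
  by_cases hp : p ∈ frontier D
  swap
  · by_cases hpD : p ∈ D
    · exact ⟨D, hD, hpD, hasFluxBound_of_ae hD (Or.inl rfl)
        (Eventually.of_forall fun q hq => by simp [hq])⟩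
    · refine ⟨(closure D)ᶜ, isClosed_closure.isOpen_compl, ?_, hasFluxBound_of_ae hD (Or.inr rfl)
        (Eventually.of_forall fun q hq => ?_)⟩
      · intro h; exact hp (hD.frontier_eq ▸ ⟨h, hpD⟩)
      · simpa using fun h => hq (subset_closure h)
  obtain ⟨U, φ, hU, hpU, hφ, hdφ, heq⟩ := hc p hp
  have hφ1 : ContDiffOn ℝ 1 φ U := hφ.of_le (by simp)
  have hp0 : φ p = 0 := by
    have : p ∈ {q ∈ U | φ q = 0} := heq ▸ ⟨hp, hpU⟩
    exact this.2
  have heq' : frontier D ∩ U = {q ∈ U | (-φ) q = 0} := by simpa using heq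
  obtain ⟨b, r, hbU, hb⟩ := exists_isFlatBox hU hpU hφ1 hp0 (hdφ p hpU) hK
  -- A second square, for `-φ`, lets the negative side be treated by the same lemmas.
  obtain ⟨b', r', hbU', hb'⟩ := exists_isFlatBox hU hpU hφ1.neg (p := p) (by simpa using hp0)
    (by
      have : fderiv ℝ (fun q => -φ q) p = -fderiv ℝ φ p := fderiv_fun_neg
      rw [this]; exact neg_ne_zero.2 (hdφ p hpU)) hK
  have hK0 : 0 ≤ K := by linarith
  have hpmem : ∀ {b r} {φ : Plane → ℝ}, IsFlatBox φ p b r K → p ∈ box p b r := by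
    intro b r φ h
    simp [box, h.pos]
  set V := box p b r ∩ box p b' r' with hVdef
  have hdis : ∀ q ∈ U, φ q ≠ 0 → q ∉ frontier D := fun q hq hne hf => by
    have : q ∈ {q ∈ U | φ q = 0} := heq ▸ ⟨hf, hq⟩
    exact hne this.2
  have hzero : ∀ q ∈ U, φ q = 0 → q ∉ D := fun q hq h0 hqD => by
    have : q ∈ frontier D ∩ U := heq ▸ ⟨hq, h0⟩
    exact (hD.frontier_eq ▸ this.1 : q ∈ closure D \ D).2 hqD
  have c1 := subset_or_disjoint_of_disjoint_frontier hb.isPreconnected_pos hD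
    (Set.disjoint_left.2 fun q hq => hdis q (hbU hq.1) hq.2.ne')
  have c2 := subset_or_disjoint_of_disjoint_frontier hb'.isPreconnected_pos hD
    (Set.disjoint_left.2 fun q hq => hdis q (hbU' hq.1) (neg_pos.1 hq.2).ne)
  refine ⟨V, isOpen_box.inter isOpen_box, ⟨hpmem hb, hpmem hb'⟩, ?_⟩
  have hnull : ∀ᵐ q, q ∈ V → φ q ≠ 0 := by
    have := hb.volume_zero
    rw [measure_eq_zero_iff_ae_notMem] at this
    filter_upwards [this] with q hq hqV h0
    exact hq ⟨hqV.1, h0⟩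
  rcases c1 with c1 | c1 <;> rcases c2 with c2 | c2
  -- `D` lies on both sides: the curve is a slit of measure zero and contributes no flux.
  · refine hasFluxBound_of_ae hD (Or.inl rfl) ?_
    filter_upwards [hnull] with q hq hqV
    refine iff_of_true ?_ (mem_univ q)
    rcases lt_or_gt_of_ne (hq hqV) with hlt | hlt
    · exact c2 ⟨hqV.2, neg_pos.2 hlt⟩
    · exact c1 ⟨hqV.1, hlt⟩
  · refine hasFluxBound_of_ae_pos hD hb hK0 inter_subset_left hbU heq fun q hq => ?_
    refine ⟨fun hqD => ?_, fun h => c1 ⟨hq.1, h⟩⟩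
    by_contra hle
    rcases (not_lt.1 hle).lt_or_eq with hlt | h0
    · exact Set.disjoint_left.1 c2 ⟨hq.2, neg_pos.2 hlt⟩ hqD
    · exact hzero q (hbU hq.1) h0 hqD
  · refine hasFluxBound_of_ae_pos hD hb' hK0 inter_subset_right hbU' heq' fun q hq => ?_
    refine ⟨fun hqD => ?_, fun h => c2 ⟨hq.2, h⟩⟩
    by_contra hle
    rcases (not_lt.1 hle).lt_or_eq with hlt | h0
    · exact Set.disjoint_left.1 c1 ⟨hq.1, neg_neg_iff_pos.1 hlt⟩ hqD
    · exact hzero q (hbU hq.1) (neg_eq_zero.1 h0) hqD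
  -- `D` lies on neither side, so it is null near `p`; no contradiction has to be derived.
  · refine hasFluxBound_of_ae hD (Or.inr rfl) ?_
    filter_upwards [hnull] with q hq hqV
    refine iff_of_false ?_ (notMem_empty q)
    rcases lt_or_gt_of_ne (hq hqV) with hlt | hlt
    · exact Set.disjoint_left.1 c2 ⟨hqV.2, neg_pos.2 hlt⟩
    · exact Set.disjoint_left.1 c1 ⟨hqV.1, hlt⟩

end

/-! ### The flux bound and the Cheeger constant -/

section

theorem contDiff_smul_of_tsupport_subset {E : Type*} [NormedAddCommGroup E] [NormedSpace ℝ E]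
    {Ω : Set Plane} (hΩ : IsOpen Ω) {ρ : Plane → ℝ} {F : Plane → E} (hρ : ContDiff ℝ 1 ρ)
    (hF : ContDiffOn ℝ 1 F Ω) (hsub : tsupport ρ ⊆ Ω) : ContDiff ℝ 1 fun q => ρ q • F q := by
  rw [contDiff_iff_contDiffAt]
  intro q
  by_cases hq : q ∈ tsupport ρ
  · exact hρ.contDiffAt.smul (hF.contDiffAt (hΩ.mem_nhds (hsub hq)))
  · have h0 : ρ =ᶠ[𝓝 q] 0 := notMem_tsupport_iff_eventuallyEq.1 hq
    refine (contDiffAt_const (c := (0 : E))).congr_of_eventuallyEq ?_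
    filter_upwards [h0] with x hx
    simp [hx]

theorem divergence_sum {ι : Type*} (T : Finset ι) {G : ι → Plane → Plane}
    (hG : ∀ i ∈ T, ContDiff ℝ 1 (G i)) (q : Plane) :
    divergence (fun q => ∑ i ∈ T, G i q) q = ∑ i ∈ T, divergence (G i) q := by
  unfold divergence
  rw [fderiv_fun_sum fun i hi => (hG i hi).differentiable one_ne_zero q]
  simp [Finset.sum_add_distrib]

theorem ofReal_sum_le_sum_ofReal {ι : Type*} (T : Finset ι) (f : ι → ℝ) :
    ENNReal.ofReal (∑ i ∈ T, f i) ≤ ∑ i ∈ T, ENNReal.ofReal (f i) :=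
  Finset.le_sum_of_subadditive _ ENNReal.ofReal_zero.le (fun _ _ => ENNReal.ofReal_add_le) T f

/-- Cut `F` and its majorant `δ⁻¹` with the same partition of unity on `closure D`. The local flux
bounds add up because the functions sum to one there; finally `K` tends to one. -/
theorem ofReal_setIntegral_divergence_le {Ω D : Set Plane} (hΩ : IsOpen Ω) (hD : IsRegular Ω D)
    {δ : Plane → ℝ} (hδ : ContDiffOn ℝ 1 δ Ω) (hδpos : ∀ p ∈ Ω, 0 < δ p) {F : Plane → Plane}
    (hF : ContDiffOn ℝ 1 F Ω) (hFδ : ∀ q ∈ Ω, ‖F q‖ ≤ (δ q)⁻¹) :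
    ENNReal.ofReal (∫ q in D, divergence F q) ≤ length δ (frontier D) := by
  have hδinv : ContDiffOn ℝ 1 (fun q => (δ q)⁻¹) Ω := hδ.inv fun q hq => (hδpos q hq).ne'
  have key : ∀ K : ℝ, 1 < K → ENNReal.ofReal (∫ q in D, divergence F q)
      ≤ ENNReal.ofReal K * length δ (frontier D) := by
    intro K hK
    choose V hVo hVp hVb using
      exists_hasFluxBound hD.isOpen hD.isSmoothCurve_frontier hK
    -- The factor `Ω` makes the products with `F` and `δ⁻¹` of class `C¹` on the whole plane; the
    -- unit ball makes the supports compact.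
    set U : Plane → Set Plane := fun p => V p ∩ Ω ∩ Metric.ball p 1 with hUdef
    obtain ⟨f, hf⟩ := SmoothPartitionOfUnity.exists_isSubordinate 𝓘(ℝ, Plane)
      (isClosed_closure (s := D)) U
      (fun p => ((hVo p).inter hΩ).inter Metric.isOpen_ball)
      (fun p hp => mem_iUnion.2 ⟨p, ⟨hVp p, hD.closure_subset hp⟩, Metric.mem_ball_self one_pos⟩)
    have hfin := f.locallyFinite.finite_nonempty_inter_compact hD.isCompact_closure
    set T : Finset Plane := hfin.toFinset with hT
    have hsum : ∀ q ∈ closure D, ∑ i ∈ T, f i q = 1 := by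
      intro q hq
      rw [← f.sum_eq_one hq]
      refine (finsum_eq_sum_of_support_subset _ fun i hi => ?_).symm
      rw [Finset.mem_coe, hT, Set.Finite.mem_toFinset]
      exact ⟨q, hi, hq⟩
    have hfs : ∀ i, ContDiff ℝ 1 (f i) := fun i =>
      ((f i).contMDiff.contDiff).of_le (by simp)
    have hfU : ∀ i, tsupport (f i) ⊆ U i := hf
    have hfΩ : ∀ i, tsupport (f i) ⊆ Ω := fun i q hq => (hfU i hq).1.2
    have hfc : ∀ i, HasCompactSupport (f i) := fun i =>
      Metric.isCompact_of_isClosed_isBounded (isClosed_tsupport _)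
        (Metric.isBounded_ball.subset fun q hq => (hfU i hq).2)
    have hG : ∀ i, ContDiff ℝ 1 fun q => f i q • F q := fun i =>
      contDiff_smul_of_tsupport_subset hΩ (hfs i) hF (hfΩ i)
    have hψ : ∀ i, ContDiff ℝ 1 fun q => f i q • (δ q)⁻¹ := fun i =>
      contDiff_smul_of_tsupport_subset hΩ (hfs i) hδinv (hfΩ i)
    have hGs : ∀ i, tsupport (fun q => f i q • F q) ⊆ tsupport (f i) := fun i =>
      tsupport_smul_subset_left _ _
    have hψs : ∀ i, tsupport (fun q => f i q • (δ q)⁻¹) ⊆ tsupport (f i) := fun i =>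
      tsupport_smul_subset_left _ _
    have hbound : ∀ i, ENNReal.ofReal (∫ q in D, divergence (fun q => f i q • F q) q)
        ≤ ENNReal.ofReal K * ∫⁻ q in frontier D, ENNReal.ofReal (f i q • (δ q)⁻¹) ∂μH[1] := by
      intro i
      refine hVb i _ _ (hG i) (hfc i).smul_right
        ((hGs i).trans fun q hq => (hfU i hq).1.1) (hψ i) (hfc i).smul_right
        ((hψs i).trans fun q hq => (hfU i hq).1.1) fun q => ?_
      rw [norm_smul, Real.norm_of_nonneg (f.nonneg i q), smul_eq_mul]
      by_cases hq : q ∈ Ω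
      · exact mul_le_mul_of_nonneg_left (hFδ q hq) (f.nonneg i q)
      · have : f i q = 0 := image_eq_zero_of_notMem_tsupport fun h => hq (hfΩ i h)
        simp [this]
    have e1 : ∫ q in D, divergence F q
        = ∑ i ∈ T, ∫ q in D, divergence (fun q => f i q • F q) q := by
      rw [← integral_finsetSum]
      · refine setIntegral_congr_fun hD.isOpen.measurableSet fun q hq => ?_
        rw [← divergence_sum T fun i _ => hG i]
        refine divergence_congr ?_
        filter_upwards [hD.isOpen.mem_nhds hq] with x hx
        rw [← Finset.sum_smul, hsum x (subset_closure hx), one_smul]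
      · intro i _
        exact ((continuous_divergence (hG i)).integrable_of_hasCompactSupport
          ((hfc i).smul_right.of_isClosed_subset (isClosed_tsupport _)
            (tsupport_divergence_subset _))).integrableOn
    have e2 : length δ (frontier D)
        = ∑ i ∈ T, ∫⁻ q in frontier D, ENNReal.ofReal (f i q • (δ q)⁻¹) ∂μH[1] := by
      rw [← lintegral_finsetSum]
      · refine setLIntegral_congr_fun isClosed_frontier.measurableSet fun q hq => ?_
        have hq' : q ∈ closure D := frontier_subset_closure hq
        rw [← ENNReal.ofReal_sum_of_nonneg, ← Finset.sum_smul, hsum q hq', one_smul]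
        intro i _
        exact mul_nonneg (f.nonneg i q) (inv_nonneg.2 (hδpos q (hD.closure_subset hq')).le)
      · intro i _
        exact (hψ i).continuous.measurable.ennreal_ofReal
    rw [e1, e2, Finset.mul_sum]
    exact (ofReal_sum_le_sum_ofReal T _).trans (Finset.sum_le_sum fun i _ => hbound i)
  -- The limit factor is nonzero, so this also holds if the length is infinite.
  have hlim : Tendsto (fun K : ℝ => ENNReal.ofReal K * length δ (frontier D)) (𝓝[>] 1)
      (𝓝 (ENNReal.ofReal 1 * length δ (frontier D))) := by
    refine ENNReal.Tendsto.mul_const ?_ (Or.inl (by simp))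
    exact (ENNReal.continuous_ofReal.tendsto 1).mono_left nhdsWithin_le_nhds
  rw [ENNReal.ofReal_one, one_mul] at hlim
  refine ge_of_tendsto hlim ?_
  filter_upwards [self_mem_nhdsWithin] with K hK using key K hK

theorem area_ne_zero {Ω D : Set Plane} (hD : IsRegular Ω D) {δ : Plane → ℝ}
    (hδ : ContinuousOn δ Ω) (hδpos : ∀ p ∈ Ω, 0 < δ p) : area δ D ≠ 0 := by
  have hDΩ : D ⊆ Ω := subset_closure.trans hD.closure_subset
  have hc : ContinuousOn (fun q => (δ q)⁻¹ ^ 2) D :=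
    ((hδ.mono hDΩ).inv₀ fun q hq => (hδpos q (hDΩ hq)).ne').pow 2
  unfold area
  rw [Ne, lintegral_eq_zero_iff' (hc.aemeasurable hD.isOpen.measurableSet).ennreal_ofReal]
  intro h0
  have h1 : ∀ᵐ q ∂volume.restrict D, False := by
    filter_upwards [h0, ae_restrict_mem hD.isOpen.measurableSet] with q hq hqD
    have := hδpos q (hDΩ hqD)
    exact (ENNReal.ofReal_pos.2 (show 0 < (δ q)⁻¹ ^ 2 by positivity)).ne' hq
  rw [eventually_false_iff_eq_bot, ae_eq_bot, Measure.restrict_eq_zero] at h1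
  exact (hD.isOpen.measure_pos volume hD.nonempty).ne' h1

/-- Integrate `div F = 2 h δ⁻² ≥ 2 (inf h) δ⁻²` over `D` and bound the flux by the length. The area
is positive and finite, so the quotient can be cleared. -/
theorem two_mul_iInf_le_cheeger_of_nonneg {Ω : Set Plane} (hΩ : IsOpen Ω) {δ : Plane → ℝ}
    (hδ : ContDiffOn ℝ 1 δ Ω) (hδpos : ∀ p ∈ Ω, 0 < δ p) {F : Plane → Plane} {h : Plane → ℝ}
    (hF : ContDiffOn ℝ 1 F Ω) (hFδ : ∀ q ∈ Ω, ‖F q‖ ≤ (δ q)⁻¹) (hh : ContinuousOn h Ω)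
    (hdiv : ∀ q ∈ Ω, divergence F q = 2 * h q * (δ q)⁻¹ ^ 2) (hpos : ∀ q ∈ Ω, 0 ≤ h q) :
    2 * ⨅ p ∈ Ω, ENNReal.ofReal |h p| ≤ cheeger Ω δ := by
  refine le_iInf₂ fun D hD => ?_
  have hDΩ : D ⊆ Ω := subset_closure.trans hD.closure_subset
  have hδc := hδ.continuousOn
  have hci : ContinuousOn (fun q => (δ q)⁻¹ ^ 2) Ω :=
    (hδc.inv₀ fun q hq => (hδpos q hq).ne').pow 2
  have hintegrable : ∀ g : Plane → ℝ, ContinuousOn g Ω → IntegrableOn g D := fun g hg =>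
    ((hg.mono hD.closure_subset).integrableOn_compact hD.isCompact_closure).mono_set
      subset_closure
  have hafin : area δ D ≠ ⊤ := by
    have := (hintegrable _ hci).lintegral_lt_top
    exact this.ne
  rw [ENNReal.le_div_iff_mul_le (Or.inl (area_ne_zero hD hδc hδpos)) (Or.inl hafin)]
  refine le_trans ?_ (ofReal_setIntegral_divergence_le hΩ hD hδ hδpos hF hFδ)
  have hms := hD.isOpen.measurableSet
  have e1 : ∫ q in D, divergence F q = ∫ q in D, 2 * h q * (δ q)⁻¹ ^ 2 :=
    setIntegral_congr_fun hms fun q hq => hdiv q (hDΩ hq)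
  rw [e1, ofReal_integral_eq_lintegral_ofReal (hintegrable
    (fun q => 2 * h q * (δ q)⁻¹ ^ 2) ((continuousOn_const.mul hh).mul hci))]
  · unfold area
    rw [← lintegral_const_mul'' _
      ((hci.mono hDΩ).aemeasurable hms).ennreal_ofReal]
    refine setLIntegral_mono' hms fun q hq => ?_
    have hq' := hDΩ hq
    have h0 := hpos q hq'
    rw [ENNReal.ofReal_mul (by positivity), ENNReal.ofReal_mul (by norm_num)]
    gcongr
    · simp
    · exact (iInf₂_le q hq').trans (by rw [abs_of_nonneg h0])
  · filter_upwards [ae_restrict_mem hms] with q hq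
    have h0 := hpos q (hDΩ hq)
    simp only [Pi.zero_apply]
    positivity

theorem divergence_neg (F : Plane → Plane) (q : Plane) :
    divergence (fun q => -F q) q = -divergence F q := by
  have : fderiv ℝ (fun q => -F q) q = -fderiv ℝ F q := fderiv_fun_neg
  simp only [divergence, this, neg_apply, PiLp.neg_apply]
  ring

/-- A strict inequality would force `|h|` to have positive infimum, so `h` has no zero and, by the
intermediate value theorem, constant sign. Then `F` or `-F` gives the opposite inequality. -/
theorem not_cheeger_lt_of_divergence {Ω : Set Plane} (hΩ : IsOpen Ω) (hconn : IsPreconnected Ω)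
    {δ : Plane → ℝ} (hδ : ContDiffOn ℝ 1 δ Ω) (hδpos : ∀ p ∈ Ω, 0 < δ p) {F : Plane → Plane}
    {h : Plane → ℝ} (hF : ContDiffOn ℝ 1 F Ω) (hFδ : ∀ q ∈ Ω, ‖F q‖ ≤ (δ q)⁻¹)
    (hh : ContinuousOn h Ω) (hdiv : ∀ q ∈ Ω, divergence F q = 2 * h q * (δ q)⁻¹ ^ 2) :
    ¬ cheeger Ω δ / 2 < ⨅ p ∈ Ω, ENNReal.ofReal |h p| := by
  intro hlt
  have hne : ∀ q ∈ Ω, h q ≠ 0 := by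
    intro q hq h0
    have : ⨅ p ∈ Ω, ENNReal.ofReal |h p| ≤ 0 := (iInf₂_le q hq).trans (by simp [h0])
    exact not_lt_bot (hlt.trans_le this)
  have hsign : (∀ q ∈ Ω, 0 ≤ h q) ∨ (∀ q ∈ Ω, 0 ≤ -h q) := by
    by_contra hc
    push Not at hc
    obtain ⟨⟨x, hx, hx0⟩, y, hy, hy0⟩ := hc
    obtain ⟨z, hz, hz0⟩ := hconn.intermediate_value hx hy hh
      (show (0 : ℝ) ∈ Icc (h x) (h y) from ⟨hx0.le, by linarith⟩)
    exact hne z hz hz0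
  have hle : 2 * ⨅ p ∈ Ω, ENNReal.ofReal |h p| ≤ cheeger Ω δ := by
    rcases hsign with hs | hs
    · exact two_mul_iInf_le_cheeger_of_nonneg hΩ hδ hδpos hF hFδ hh hdiv hs
    · have := two_mul_iInf_le_cheeger_of_nonneg hΩ hδ hδpos hF.neg
        (fun q hq => by simpa using hFδ q hq) hh.neg
        (fun q hq => by
          rw [divergence_neg, hdiv q hq, Pi.neg_apply]
          ring) hs
      simpa using this
  refine absurd hlt (not_lt.2 ?_)
  rw [ENNReal.le_div_iff_mul_le (by simp) (by simp), mul_comm]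
  exact hle

end

/-! ### The Calabi potential -/

section

/-- The radial primitive `∫₀¹ t h(t p) dt`. -/
def radial (h : Plane → ℝ) (p : Plane) : ℝ := ∫ t in (0 : ℝ)..1, t * h (t • p)

theorem calabi_eq (δ τ : Plane → ℝ) (p : Plane) :
    calabi δ τ p = 2 * radial (fun q => τ q / δ q ^ 2) p := rfl

theorem hasFDerivAt_radial {h : Plane → ℝ} (hh : ContDiff ℝ 1 h) (hc : HasCompactSupport h)
    (p : Plane) :
    HasFDerivAt (radial h) (∫ t in (0 : ℝ)..1, (t * t) • fderiv ℝ h (t • p)) p := by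
  have hcd : Continuous (fderiv ℝ h) := hh.continuous_fderiv one_ne_zero
  obtain ⟨B, hB⟩ := (hc.fderiv (𝕜 := ℝ)).exists_bound_of_continuous hcd
  have hB0 : 0 ≤ B := (norm_nonneg _).trans (hB 0)
  refine intervalIntegral.hasFDerivAt_integral_of_dominated_of_fderiv_le (s := univ)
    (F := fun p t => t * h (t • p)) (F' := fun p t => (t * t) • fderiv ℝ h (t • p))
    (bound := fun _ => B) univ_mem ?_ ?_ ?_ ?_ ?_ ?_
  · refine Eventually.of_forall fun q => Continuous.aestronglyMeasurable ?_
    exact continuous_id.mul (hh.continuous.comp (by fun_prop))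
  · refine Continuous.intervalIntegrable ?_ _ _
    exact continuous_id.mul (hh.continuous.comp (by fun_prop))
  · refine Continuous.aestronglyMeasurable ?_
    exact (by fun_prop : Continuous fun t : ℝ => t * t).smul (hcd.comp (by fun_prop))
  · refine Eventually.of_forall fun t ht q _ => ?_
    rw [uIoc_of_le zero_le_one] at ht
    rw [norm_smul, Real.norm_of_nonneg (mul_self_nonneg t)]
    have h1 : t * t ≤ 1 := by nlinarith [ht.1, ht.2]
    calc t * t * ‖fderiv ℝ h (t • q)‖ ≤ 1 * B :=
          mul_le_mul h1 (hB _) (norm_nonneg _) zero_le_one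
      _ = B := one_mul B
  · exact intervalIntegrable_const
  · refine Eventually.of_forall fun t _ q _ => ?_
    have h1 : HasFDerivAt (fun q : Plane => t • q) (t • ContinuousLinearMap.id ℝ Plane) q :=
      (hasFDerivAt_id q).const_smul t
    have h2 := (((hh.differentiable one_ne_zero (t • q)).hasFDerivAt.comp q h1).const_mul t)
    have e : (t * t) • fderiv ℝ h (t • q)
        = t • (fderiv ℝ h (t • q) ∘SL (t • ContinuousLinearMap.id ℝ Plane)) := by
      ext v
      simp [mul_assoc]
    rw [e]
    exact h2

theorem contDiff_radial {h : Plane → ℝ} (hh : ContDiff ℝ 1 h) (hc : HasCompactSupport h) :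
    ContDiff ℝ 1 (radial h) := by
  rw [contDiff_one_iff_fderiv]
  refine ⟨fun p => (hasFDerivAt_radial hh hc p).differentiableAt, ?_⟩
  have : fderiv ℝ (radial h) = fun p => ∫ t in (0 : ℝ)..1, (t * t) • fderiv ℝ h (t • p) :=
    funext fun p => (hasFDerivAt_radial hh hc p).fderiv
  rw [this]
  refine intervalIntegral.continuous_parametric_intervalIntegral_of_continuous' ?_ 0 1
  have hcd : Continuous (fderiv ℝ h) := hh.continuous_fderiv one_ne_zero
  exact (by fun_prop : Continuous fun z : Plane × ℝ => z.2 * z.2).smul (hcd.comp (by fun_prop))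

/-- The substitution `r = s t` turns `s² radial h (s p)` into the integral of `r h (r p)` over `[0,
s]`; both forms are differentiated at `s = 1`. -/
theorem radial_identity {h : Plane → ℝ} (hh : ContDiff ℝ 1 h) (hc : HasCompactSupport h)
    (p : Plane) : 2 * radial h p + fderiv ℝ (radial h) p p = h p := by
  have hf : Continuous fun r : ℝ => r * h (r • p) :=
    continuous_id.mul (hh.continuous.comp (by fun_prop))
  have e : (fun s : ℝ => s ^ 2 * radial h (s • p)) = fun s => ∫ r in (0 : ℝ)..s, r * h (r • p) := by
    ext s
    rcases eq_or_ne s 0 with rfl | hs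
    · simp
    · have := intervalIntegral.integral_comp_mul_right (a := 0) (b := 1)
        (fun r : ℝ => r * h (r • p)) hs
      rw [zero_mul, one_mul, smul_eq_mul, eq_inv_mul_iff_mul_eq₀ hs] at this
      rw [← this, radial, ← intervalIntegral.integral_const_mul,
        ← intervalIntegral.integral_const_mul]
      congr 1; ext t
      rw [smul_smul]; ring
  have d1 : HasDerivAt (fun s => ∫ r in (0 : ℝ)..s, r * h (r • p)) (1 * h ((1 : ℝ) • p)) 1 :=
    hf.integral_hasStrictDerivAt 0 1 |>.hasDerivAt
  have d2 : HasDerivAt (fun s : ℝ => s ^ 2 * radial h (s • p))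
      (2 * radial h p + fderiv ℝ (radial h) p p) 1 := by
    have h1 : HasDerivAt (fun s : ℝ => s • p) p 1 := by
      simpa using (hasDerivAt_id (1 : ℝ)).smul_const p
    have h2 : HasFDerivAt (radial h) (fderiv ℝ (radial h) p) ((1 : ℝ) • p) := by
      rw [one_smul]; exact (hasFDerivAt_radial hh hc p).differentiableAt.hasFDerivAt
    have h3 := (hasDerivAt_pow 2 (1 : ℝ)).mul (h2.comp_hasDerivAt 1 h1)
    refine h3.congr_deriv ?_
    simp
  rw [e] at d2
  simpa using d2.unique d1

/-- The values of `radial h` near `p` involve `h` only on the compact cone over a small ball, which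
lies in `Ω` by star-shapedness. A cut-off equal to one there reduces everything to compactly
supported functions on the plane. -/
theorem radial_local {Ω : Set Plane} (hΩ : IsOpen Ω) (hstar : StarConvex ℝ 0 Ω) {h : Plane → ℝ}
    (hh : ContDiffOn ℝ 1 h Ω) {p : Plane} (hp : p ∈ Ω) :
    ∃ g : Plane → ℝ, ContDiff ℝ 1 g ∧ HasCompactSupport g ∧ g p = h p ∧
      radial h =ᶠ[𝓝 p] radial g := by
  obtain ⟨ε, hε, hball⟩ := Metric.nhds_basis_closedBall.mem_iff.1 (hΩ.mem_nhds hp)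
  obtain ⟨K, hKc, hKΩ, hmem⟩ : ∃ K : Set Plane, IsCompact K ∧ K ⊆ Ω ∧
      ∀ q ∈ Metric.closedBall p ε, ∀ t ∈ Icc (0 : ℝ) 1, t • q ∈ K := by
    refine ⟨(fun z : ℝ × Plane => z.1 • z.2) '' (Icc 0 1 ×ˢ Metric.closedBall p ε),
      (isCompact_Icc.prod (isCompact_closedBall p ε)).image (by fun_prop), ?_,
      fun q hq t ht => ⟨(t, q), ⟨ht, hq⟩, rfl⟩⟩
    rintro _ ⟨⟨t, q⟩, ⟨ht, hq⟩, rfl⟩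
    exact hstar.smul_mem (hball hq) ht.1 ht.2
  obtain ⟨T, hTc, hKT, hTΩ⟩ := exists_compact_between hKc hΩ hKΩ
  obtain ⟨f, hf1, hf0, -⟩ := exists_contMDiffMap_one_nhds_of_subset_interior 𝓘(ℝ, Plane)
    (n := 1) hKc.isClosed hKT
  have hfT : tsupport f ⊆ T := closure_minimal
    (fun q hq => by by_contra h; exact hq (hf0 q h)) hTc.isClosed
  have hf1' : ∀ q ∈ K, f q = 1 := fun q hq => hf1.self_of_nhdsSet q hq
  have hfd : ContDiff ℝ 1 f := f.contMDiff.contDiff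
  have hfc : HasCompactSupport f := hTc.of_isClosed_subset (isClosed_tsupport _) hfT
  refine ⟨fun q => f q • h q, contDiff_smul_of_tsupport_subset hΩ hfd hh (hfT.trans hTΩ),
    hfc.smul_right, ?_, ?_⟩
  · have : p ∈ K := by
      simpa using hmem p (Metric.mem_closedBall_self hε.le) 1 ⟨zero_le_one, le_rfl⟩
    simp [hf1' p this]
  · filter_upwards [Metric.closedBall_mem_nhds p hε] with q hq
    refine intervalIntegral.integral_congr fun t ht => ?_
    rw [uIcc_of_le zero_le_one] at ht
    simp [hf1' _ (hmem q hq t ht)]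

theorem contDiffOn_calabi {Ω : Set Plane} (hΩ : IsOpen Ω) (hstar : StarConvex ℝ 0 Ω)
    {δ τ : Plane → ℝ} (hδ : ContDiffOn ℝ 1 δ Ω) (hδpos : ∀ p ∈ Ω, 0 < δ p)
    (hτ : ContDiffOn ℝ 1 τ Ω) : ContDiffOn ℝ 1 (calabi δ τ) Ω := by
  intro p hp
  have hh : ContDiffOn ℝ 1 (fun q => τ q / δ q ^ 2) Ω :=
    hτ.div (hδ.pow 2) fun q hq => (pow_pos (hδpos q hq) 2).ne'
  obtain ⟨g, hg, hgc, -, he⟩ := radial_local hΩ hstar hh hp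
  refine ContDiffAt.contDiffWithinAt ?_
  exact contDiffAt_const.mul ((contDiff_radial hg hgc).contDiffAt.congr_of_eventuallyEq he)

/-- In other words, the field `q ↦ C(q) q` has divergence `2 τ δ⁻²`; this is what the Calabi
potential is designed for. -/
theorem calabi_identity {Ω : Set Plane} (hΩ : IsOpen Ω) (hstar : StarConvex ℝ 0 Ω)
    {δ τ : Plane → ℝ} (hδ : ContDiffOn ℝ 1 δ Ω) (hδpos : ∀ p ∈ Ω, 0 < δ p)
    (hτ : ContDiffOn ℝ 1 τ Ω) {p : Plane} (hp : p ∈ Ω) :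
    2 * calabi δ τ p + fderiv ℝ (calabi δ τ) p p = 2 * (τ p / δ p ^ 2) := by
  have hh : ContDiffOn ℝ 1 (fun q => τ q / δ q ^ 2) Ω :=
    hτ.div (hδ.pow 2) fun q hq => (pow_pos (hδpos q hq) 2).ne'
  obtain ⟨g, hg, hgc, hgp, he⟩ := radial_local hΩ hstar hh hp
  have h1 := radial_identity hg hgc p
  have h2 : fderiv ℝ (calabi δ τ) p = (2 : ℝ) • fderiv ℝ (radial g) p := by
    have hd := (hasFDerivAt_radial hg hgc p).differentiableAt.hasFDerivAt
    exact ((hd.congr_of_eventuallyEq he).const_mul (2 : ℝ)).fderiv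
  rw [h2, calabi_eq, he.self_of_nhds, ← hgp, ← h1]
  simp only [smul_apply, smul_eq_mul]
  ring

end

/-! ### Partial derivatives and spacelike graphs -/

section

/-- The partial derivative of `u` in the `i`-th coordinate direction. -/
def pd (u : Plane → ℝ) (i : Fin 2) (p : Plane) : ℝ := fderiv ℝ u p (EuclideanSpace.single i 1)

theorem contDiffOn_pd {Ω : Set Plane} (hΩ : IsOpen Ω) {u : Plane → ℝ} (hu : ContDiffOn ℝ 2 u Ω)
    (i : Fin 2) : ContDiffOn ℝ 1 (pd u i) Ω :=
  (hu.fderiv_of_isOpen hΩ (m := 1) (by norm_num)).clm_apply contDiffOn_const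

theorem pd_comm {Ω : Set Plane} (hΩ : IsOpen Ω) {u : Plane → ℝ} (hu : ContDiffOn ℝ 2 u Ω)
    {p : Plane} (hp : p ∈ Ω) : pd (pd u 1) 0 p = pd (pd u 0) 1 p := by
  have hd : DifferentiableAt ℝ (fderiv ℝ u) p :=
    ((hu.fderiv_of_isOpen hΩ (m := 1) (by norm_num)).contDiffAt (hΩ.mem_nhds hp)).differentiableAt
      one_ne_zero
  have key : ∀ i j, pd (pd u i) j p = fderiv ℝ (fderiv ℝ u) p (EuclideanSpace.single j 1)
      (EuclideanSpace.single i 1) := by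
    intro i j
    have := hd.hasFDerivAt.clm_apply (hasFDerivAt_const (EuclideanSpace.single i (1 : ℝ)) p)
    unfold pd
    rw [this.fderiv]
    simp
  rw [key, key]
  have hs : IsSymmSndFDerivAt ℝ u p :=
    (hu.contDiffAt (hΩ.mem_nhds hp)).isSymmSndFDerivAt (by simp)
  exact hs _ _

theorem fderiv_apply_eq (u : Plane → ℝ) (p a : Plane) :
    fderiv ℝ u p a = a 0 * pd u 0 p + a 1 * pd u 1 p := by
  conv_lhs => rw [eq_sum_coord a]
  simp [pd]

theorem divergence_eq_pd {F : Plane → Plane} {p : Plane} (hF : DifferentiableAt ℝ F p) :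
    divergence F p = pd (fun q => F q 0) 0 p + pd (fun q => F q 1) 1 p := by
  unfold pd
  rw [fderiv_coord hF, fderiv_coord hF, divergence]

/-- `f` is differentiable at `p` with partial derivatives `a`. -/
def HasPd (f : Plane → ℝ) (p : Plane) (a : Fin 2 → ℝ) : Prop :=
  ∃ L : Plane →L[ℝ] ℝ, HasFDerivAt f L p ∧ ∀ i, L (EuclideanSpace.single i 1) = a i

namespace HasPd

variable {f g : Plane → ℝ} {p : Plane} {a b : Fin 2 → ℝ}

theorem pd_eq (h : HasPd f p a) (i : Fin 2) : pd f i p = a i := by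
  obtain ⟨L, hL, hi⟩ := h
  rw [pd, hL.fderiv, hi]

theorem of_differentiableAt (h : DifferentiableAt ℝ f p) : HasPd f p fun i => pd f i p :=
  ⟨_, h.hasFDerivAt, fun _ => rfl⟩

theorem coord (j : Fin 2) (p : Plane) :
    HasPd (fun q => q j) p fun i => if j = i then 1 else 0 :=
  ⟨_, (EuclideanSpace.proj (𝕜 := ℝ) j : Plane →L[ℝ] ℝ).hasFDerivAt, fun i => by
    simp⟩

theorem const (c : ℝ) (p : Plane) : HasPd (fun _ => c) p fun _ => 0 :=
  ⟨_, hasFDerivAt_const c p, fun _ => rfl⟩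

theorem add (hf : HasPd f p a) (hg : HasPd g p b) :
    HasPd (fun q => f q + g q) p fun i => a i + b i := by
  obtain ⟨L, hL, hi⟩ := hf
  obtain ⟨M, hM, hj⟩ := hg
  exact ⟨_, hL.add hM, fun i => by simp [hi, hj]⟩

theorem neg (hf : HasPd f p a) : HasPd (fun q => -f q) p fun i => -a i := by
  obtain ⟨L, hL, hi⟩ := hf
  exact ⟨_, hL.neg, fun i => by simp [hi]⟩

theorem sub (hf : HasPd f p a) (hg : HasPd g p b) :
    HasPd (fun q => f q - g q) p fun i => a i - b i := by
  obtain ⟨L, hL, hi⟩ := hf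
  obtain ⟨M, hM, hj⟩ := hg
  exact ⟨_, hL.sub hM, fun i => by simp [hi, hj]⟩

theorem mul (hf : HasPd f p a) (hg : HasPd g p b) :
    HasPd (fun q => f q * g q) p fun i => a i * g p + f p * b i := by
  obtain ⟨L, hL, hi⟩ := hf
  obtain ⟨M, hM, hj⟩ := hg
  exact ⟨_, hL.mul hM, fun i => by simp [hi, hj]; ring⟩

theorem comp_hasDerivAt {φ : ℝ → ℝ} {c : ℝ} (hf : HasPd f p a) (hφ : HasDerivAt φ c (f p)) :
    HasPd (fun q => φ (f q)) p fun i => c * a i := by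
  obtain ⟨L, hL, hi⟩ := hf
  exact ⟨_, hφ.comp_hasFDerivAt p hL, fun i => by simp [hi]⟩

theorem sqrt (hf : HasPd f p a) (h0 : 0 < f p) :
    HasPd (fun q => √(f q)) p fun i => a i / (2 * √(f p)) := by
  have := hf.comp_hasDerivAt (Real.hasDerivAt_sqrt h0.ne')
  simpa [div_eq_inv_mul] using this

theorem inv (hf : HasPd f p a) (h0 : f p ≠ 0) :
    HasPd (fun q => (f q)⁻¹) p fun i => -a i / f p ^ 2 := by
  have := hf.comp_hasDerivAt (hasDerivAt_inv h0)
  have e : (fun i => -a i / f p ^ 2) = fun i => -(f p ^ 2)⁻¹ * a i := by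
    funext i; rw [div_eq_mul_inv]; ring
  rw [e]
  exact this

end HasPd

/-- The plane field with components `f` and `g`. -/
def pairField (f g : Plane → ℝ) (q : Plane) : Plane := !₂[f q, g q]

theorem contDiffOn_pairField {Ω : Set Plane} {f g : Plane → ℝ} (hf : ContDiffOn ℝ 1 f Ω)
    (hg : ContDiffOn ℝ 1 g Ω) : ContDiffOn ℝ 1 (pairField f g) Ω := by
  rw [contDiffOn_euclidean]
  intro i
  fin_cases i
  · exact hf
  · exact hg

theorem norm_pairField_le {f g : Plane → ℝ} {q : Plane} {c : ℝ} (hc : 0 ≤ c)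
    (h : f q ^ 2 + g q ^ 2 ≤ c ^ 2) : ‖pairField f g q‖ ≤ c := by
  rw [EuclideanSpace.norm_eq]
  refine Real.sqrt_le_iff.2 ⟨hc, ?_⟩
  simpa [pairField, Fin.sum_univ_two] using h

theorem fderiv_graph {u : Plane → ℝ} {p : Plane} (hu : DifferentiableAt ℝ u p) (a : Plane) :
    fderiv ℝ (graph u) p a = (a, fderiv ℝ u p a) := by
  have h : HasFDerivAt (graph u) ((ContinuousLinearMap.id ℝ Plane).prod (fderiv ℝ u p)) p :=
    (hasFDerivAt_id p).prodMk hu.hasFDerivAt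
  rw [h.fderiv]
  rfl

theorem contDiffOn_coord (Ω : Set Plane) (i : Fin 2) :
    ContDiffOn ℝ 1 (fun q : Plane => q i) Ω := by fun_prop

/-- The calibrating field is `(β, -α)`, where `α`, `β` are the values of `dz - C (y dx - x dy)` on
the coordinate tangent vectors of the graph. -/
theorem not_isEntireSpacelikeGraph {Ω : Set Plane} (hΩ : IsOpen Ω)
    (hstar : StarConvex ℝ 0 Ω) (hconn : IsPreconnected Ω) {δ τ u : Plane → ℝ}
    (hδ : ContDiffOn ℝ 1 δ Ω) (hδpos : ∀ p ∈ Ω, 0 < δ p) (hτ : ContDiffOn ℝ 1 τ Ω)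
    (hlt : cheeger Ω δ / 2 < ⨅ p ∈ Ω, ENNReal.ofReal |τ p|) :
    ¬ IsEntireSpacelikeGraph Ω δ τ u := by
  rintro ⟨hu, hsp⟩
  set C := calabi δ τ with hC
  have hCd : ContDiffOn ℝ 1 C Ω := contDiffOn_calabi hΩ hstar hδ hδpos hτ
  have hu0 := contDiffOn_pd hΩ hu 0
  have hu1 := contDiffOn_pd hΩ hu 1
  have hf : ContDiffOn ℝ 1 (fun q : Plane => pd u 1 q + C q * q 0) Ω :=
    hu1.add (hCd.mul (contDiffOn_coord Ω 0))
  have hg : ContDiffOn ℝ 1 (fun q : Plane => -(pd u 0 q - C q * q 1)) Ω :=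
    (hu0.sub (hCd.mul (contDiffOn_coord Ω 1))).neg
  have hF := contDiffOn_pairField hf hg
  refine not_cheeger_lt_of_divergence hΩ hconn hδ hδpos hF (fun q hq => ?_) hτ.continuousOn
    (fun q hq => ?_) hlt
  · have hd := hδpos q hq
    refine norm_pairField_le (inv_nonneg.2 hd.le) ?_
    set α := pd u 0 q - C q * q 1 with hα
    set β := pd u 1 q + C q * q 0 with hβ
    by_cases h0 : α = 0 ∧ β = 0
    · rw [h0.1, h0.2]; simp; positivity
    -- Test the induced metric on `(α, β)` itself, where the form takes the value `α² + β²`;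
    -- dividing by `α² + β²` gives the bound.
    have hne : (!₂[α, β] : Plane) ≠ 0 := by
      intro h
      exact h0 ⟨by simpa using congrArg (fun w : Plane => w 0) h,
        by simpa using congrArg (fun w : Plane => w 1) h⟩
    have h1 := hsp q hq _ hne
    rw [fderiv_graph ((hu.contDiffAt (hΩ.mem_nhds hq)).differentiableAt two_ne_zero),
      fderiv_apply_eq] at h1
    simp only [metricL, baseMetric, formL, graph, ← hC] at h1
    have h2 : 0 < (α ^ 2 + β ^ 2) / δ q ^ 2 - (α ^ 2 + β ^ 2) ^ 2 := by
      convert h1 using 1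
      simp [hα, hβ]
      ring
    have hs : 0 < α ^ 2 + β ^ 2 := by
      rcases not_and_or.1 h0 with h | h <;> positivity
    rw [neg_sq, add_comm, inv_pow]
    have h3 : (α ^ 2 + β ^ 2) * ((δ q ^ 2)⁻¹ - (α ^ 2 + β ^ 2)) > 0 := by
      rw [div_eq_mul_inv] at h2; linarith
    have := (mul_pos_iff_of_pos_left hs).1 h3
    linarith
  · have hdq : ∀ {E : Type} [NormedAddCommGroup E] [NormedSpace ℝ E] {f : Plane → E},
        ContDiffOn ℝ 1 f Ω → DifferentiableAt ℝ f q := fun hf =>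
      (hf.contDiffAt (hΩ.mem_nhds hq)).differentiableAt one_ne_zero
    rw [divergence_eq_pd (hdq hF)]
    have hpd : ∀ {f : Plane → ℝ}, ContDiffOn ℝ 1 f Ω → HasPd f q fun i => pd f i q := fun hf =>
      HasPd.of_differentiableAt (hdq hf)
    have e0 := ((hpd hu1).add ((hpd hCd).mul (HasPd.coord 0 q))).pd_eq 0
    have e1 := ((hpd hu0).sub ((hpd hCd).mul (HasPd.coord 1 q))).neg.pd_eq 1
    simp only [if_true] at e0 e1
    have hid := calabi_identity hΩ hstar hδ hδpos hτ hq
    rw [← hC, fderiv_apply_eq] at hid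
    change pd (fun q : Plane => pd u 1 q + C q * q 0) 0 q
      + pd (fun q : Plane => -(pd u 0 q - C q * q 1)) 1 q = _
    -- The mixed derivatives of `u` cancel, and what remains is the left side of the Calabi
    -- identity.
    rw [e0, e1, pd_comm hΩ hu hq, inv_pow]
    rw [div_eq_mul_inv] at hid
    linarith

end

/-! ### Derivatives of the Riemannian metric -/

section

theorem trace_inv_mul_fin_two (G h : Matrix (Fin 2) (Fin 2) ℝ) :
    (G⁻¹ * h).trace = (G 1 1 * h 0 0 - G 0 1 * h 1 0 - G 1 0 * h 0 1 + G 0 0 * h 1 1)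
      / (G 0 0 * G 1 1 - G 0 1 * G 1 0) := by
  rw [Matrix.inv_def, Matrix.adjugate_fin_two, Ring.inverse_eq_inv', Matrix.det_fin_two,
    Matrix.trace_fin_two]
  simp [Matrix.mul_apply, Fin.sum_univ_two]
  ring

/-- The algebraic identity behind the divergence form of the mean curvature equation. -/
theorem mean_curvature_algebra {d W A B d0 d1 c00 c01 c10 c11 u00 u01 u11 n0 n1 ν : ℝ}
    (hd : 0 < d) (hW : 0 < W) (hW2 : W ^ 2 = 1 + d ^ 2 * (A ^ 2 + B ^ 2))
    (hn0 : n0 = -(d ^ 2 * A / W)) (hn1 : n1 = -(d ^ 2 * B / W)) (hν : ν = 1 / W)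
    {h00 h01 h10 h11 : ℝ}
    (e00 : h00 = u00 * ν + (-2 * n0 * d0 / d ^ 3 + c00 * ν + A * (n0 * c00 + n1 * c10))
      - (-2 * (d0 * n0 + d1 * n1) / d ^ 3 + 2 * A * (c00 * n0 + c01 * n1)) / 2)
    (e01 : h01 = u01 * ν + ((-2 * n1 * d0 / d ^ 3 + c10 * ν + B * (n0 * c00 + n1 * c10))
      + (-2 * n0 * d1 / d ^ 3 + c01 * ν + A * (n0 * c01 + n1 * c11))
      - ((c00 * n0 + c01 * n1) * B + A * (c10 * n0 + c11 * n1))) / 2)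
    (e10 : h10 = h01)
    (e11 : h11 = u11 * ν + (-2 * n1 * d1 / d ^ 3 + c11 * ν + B * (n0 * c01 + n1 * c11))
      - (-2 * (d0 * n0 + d1 * n1) / d ^ 3 + 2 * B * (c10 * n0 + c11 * n1)) / 2) :
    ((1 / d ^ 2 + B * B) * h00 - A * B * h10 - A * B * h01 + (1 / d ^ 2 + A * A) * h11)
      / ((1 / d ^ 2 + A * A) * (1 / d ^ 2 + B * B) - A * B * (A * B))
    = d ^ 2 * ((u00 + c00 + (u11 + c11)) / W
      - (A * (d * d0 * (A ^ 2 + B ^ 2) + d ^ 2 * (A * (u00 + c00) + B * (u01 + c10)))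
        + B * (d * d1 * (A ^ 2 + B ^ 2) + d ^ 2 * (A * (u01 + c01) + B * (u11 + c11)))) / W ^ 3) := by
  -- The determinant of the first fundamental form.
  have hdet : (1 / d ^ 2 + A * A) * (1 / d ^ 2 + B * B) - A * B * (A * B) = W ^ 2 / d ^ 4 := by
    rw [hW2]; field_simp; ring
  rw [hdet, e10, e00, e01, e11, hn0, hn1, hν]
  have hkey : (u00 + c00 + (u11 + c11)) / W
      = (u00 + c00 + (u11 + c11)) * (1 + d ^ 2 * (A ^ 2 + B ^ 2)) / W ^ 3 := by
    rw [← hW2]; field_simp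
  rw [hkey]
  field_simp
  ring

theorem hasPd_metricE {δ τ : Plane → ℝ} {p : Plane} (hδ : DifferentiableAt ℝ δ p)
    (hδ0 : δ p ≠ 0) (hC : DifferentiableAt ℝ (calabi δ τ) p) (w n : Space) :
    HasPd (fun p => metricE δ τ (p, 0) w n) p fun i =>
      -2 * (w.1 0 * n.1 0 + w.1 1 * n.1 1) * pd δ i p / δ p ^ 3
      + (pd (calabi δ τ) i p * (p 1 * w.1 0 - p 0 * w.1 1)
          + calabi δ τ p * ((if 1 = i then 1 else 0) * w.1 0 - (if 0 = i then 1 else 0) * w.1 1))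
        * formE δ τ (p, 0) n
      + formE δ τ (p, 0) w * (pd (calabi δ τ) i p * (p 1 * n.1 0 - p 0 * n.1 1)
          + calabi δ τ p * ((if 1 = i then 1 else 0) * n.1 0 - (if 0 = i then 1 else 0) * n.1 1)) := by
  have hi := (HasPd.of_differentiableAt hδ).inv hδ0
  have hlin : ∀ w : Space, HasPd (fun p => formE δ τ (p, 0) w) p _ := fun w =>
    (HasPd.const w.2 p).add ((HasPd.of_differentiableAt hC).mul
      (((HasPd.coord 1 p).mul (HasPd.const (w.1 0) p)).sub
        ((HasPd.coord 0 p).mul (HasPd.const (w.1 1) p))))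
  have h := ((HasPd.const (w.1 0 * n.1 0 + w.1 1 * n.1 1) p).mul (hi.mul hi)).add
    ((hlin w).mul (hlin n))
  have ef : (fun p => metricE δ τ (p, 0) w n) = fun p =>
      (w.1 0 * n.1 0 + w.1 1 * n.1 1) * ((δ p)⁻¹ * (δ p)⁻¹)
        + formE δ τ (p, 0) w * formE δ τ (p, 0) n := by
    funext p
    simp only [metricE, baseMetric]
    rw [div_eq_mul_inv, sq, mul_inv]
  rw [ef]
  convert h using 2
  field_simp
  ring

/-- The metric does not depend on `z`, so only the planar part of `v` contributes and
`hasPd_metricE` suffices. -/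
theorem fderiv_metricE {δ τ : Plane → ℝ} {q : Space} (hδ : DifferentiableAt ℝ δ q.1)
    (hδ0 : δ q.1 ≠ 0) (hC : DifferentiableAt ℝ (calabi δ τ) q.1) (v w n : Space) :
    fderiv ℝ (fun q' => metricE δ τ q' w n) q v =
      -2 * (w.1 0 * n.1 0 + w.1 1 * n.1 1) * fderiv ℝ δ q.1 v.1 / δ q.1 ^ 3
      + (fderiv ℝ (calabi δ τ) q.1 v.1 * (q.1 1 * w.1 0 - q.1 0 * w.1 1)
          + calabi δ τ q.1 * (v.1 1 * w.1 0 - v.1 0 * w.1 1)) * formE δ τ q n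
      + formE δ τ q w * (fderiv ℝ (calabi δ τ) q.1 v.1 * (q.1 1 * n.1 0 - q.1 0 * n.1 1)
          + calabi δ τ q.1 * (v.1 1 * n.1 0 - v.1 0 * n.1 1)) := by
  have h := hasPd_metricE hδ hδ0 hC w n
  obtain ⟨L, hL, -⟩ := id h
  have hcomp : HasFDerivAt (fun q' : Space => metricE δ τ q' w n)
      (L ∘SL ContinuousLinearMap.fst ℝ Plane ℝ) q :=
    hL.comp q (hasFDerivAt_fst (p := q))
  have e1 : fderiv ℝ (fun q' => metricE δ τ q' w n) q v
      = fderiv ℝ (fun p => metricE δ τ (p, 0) w n) q.1 v.1 := by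
    rw [hcomp.fderiv, hL.fderiv]; rfl
  rw [e1, fderiv_apply_eq, h.pd_eq, h.pd_eq, fderiv_apply_eq δ, fderiv_apply_eq (calabi δ τ)]
  have e2 : ∀ w, formE δ τ (q.1, 0) w = formE δ τ q w := fun _ => rfl
  simp only [e2, if_true, Fin.zero_eq_one_iff, Fin.one_eq_zero_iff, Nat.succ_ne_self, if_false]
  field_simp
  ring

end

/-! ### Mean curvature of graphs in divergence form -/

section

/-- The value of the form `dz + C (y dx - x dy)` on the first tangent vector of a graph. -/
def slopeX (δ τ u : Plane → ℝ) (q : Plane) : ℝ := pd u 0 q + calabi δ τ q * q 1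

/-- The value of the form `dz + C (y dx - x dy)` on the second tangent vector of a graph. -/
def slopeY (δ τ u : Plane → ℝ) (q : Plane) : ℝ := pd u 1 q - calabi δ τ q * q 0

/-- The area element of a graph relative to the base. -/
def areaElement (δ τ u : Plane → ℝ) (q : Plane) : ℝ :=
  √(1 + δ q * δ q * (slopeX δ τ u q * slopeX δ τ u q + slopeY δ τ u q * slopeY δ τ u q))

variable {Ω : Set Plane} {δ τ u : Plane → ℝ} {p : Plane}

theorem areaElement_pos (q : Plane) : 0 < areaElement δ τ u q := by
  refine Real.sqrt_pos.2 ?_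
  nlinarith [mul_nonneg (mul_self_nonneg (δ q))
    (add_nonneg (mul_self_nonneg (slopeX δ τ u q)) (mul_self_nonneg (slopeY δ τ u q)))]

theorem areaElement_sq (q : Plane) : areaElement δ τ u q ^ 2
    = 1 + δ q ^ 2 * (slopeX δ τ u q ^ 2 + slopeY δ τ u q ^ 2) := by
  rw [areaElement, Real.sq_sqrt]
  · ring
  · nlinarith [mul_nonneg (mul_self_nonneg (δ q))
      (add_nonneg (mul_self_nonneg (slopeX δ τ u q)) (mul_self_nonneg (slopeY δ τ u q)))]

theorem tangent_graph (hu : DifferentiableAt ℝ u p) (i : Fin 2) :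
    tangent (graph u) i p = (EuclideanSpace.single i 1, pd u i p) :=
  fderiv_graph hu _

theorem fderiv_tangent_graph (hΩ : IsOpen Ω) (hu : ContDiffOn ℝ 2 u Ω) (hp : p ∈ Ω)
    (i j : Fin 2) : fderiv ℝ (tangent (graph u) j) p (EuclideanSpace.single i 1)
      = (0, pd (pd u j) i p) := by
  have he : tangent (graph u) j =ᶠ[𝓝 p] fun q => (EuclideanSpace.single j 1, pd u j q) := by
    filter_upwards [hΩ.mem_nhds hp] with q hq
    exact tangent_graph ((hu.contDiffAt (hΩ.mem_nhds hq)).differentiableAt two_ne_zero) j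
  have hd : DifferentiableAt ℝ (pd u j) p :=
    ((contDiffOn_pd hΩ hu j).contDiffAt (hΩ.mem_nhds hp)).differentiableAt one_ne_zero
  have h := (hasFDerivAt_const (EuclideanSpace.single j (1 : ℝ)) p).prodMk hd.hasFDerivAt
  rw [he.fderiv_eq, h.fderiv]
  rfl

/-- Let `ν` be the value of the form on `N`. Orthogonality to the tangent vectors makes the
horizontal part `-δ² ν` times the slopes, unit length then gives `(ν W)² = 1`, and pointing upwards
means `ν > 0`. -/
theorem upward_normal_eq (hδ : 0 < δ p) (hu : DifferentiableAt ℝ u p) {N : Space}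
    (hN : IsUpwardUnitNormal (metricE δ τ) (graph u) p N) :
    formE δ τ (graph u p) N = 1 / areaElement δ τ u p ∧
    N.1 0 = -(δ p ^ 2 * slopeX δ τ u p / areaElement δ τ u p) ∧
    N.1 1 = -(δ p ^ 2 * slopeY δ τ u p / areaElement δ τ u p) := by
  obtain ⟨h1, h2, h3⟩ := hN
  have hW := areaElement_pos (δ := δ) (τ := τ) (u := u) p
  have hW2 := areaElement_sq (δ := δ) (τ := τ) (u := u) p
  set W := areaElement δ τ u p
  have t0 := h1 0
  have t1 := h1 1
  rw [tangent_graph hu] at t0 t1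
  set ν := formE δ τ (graph u p) N with hν
  have hνpos : 0 < ν := by
    simp only [metricE, baseMetric, ← hν] at h3
    simpa [formE] using h3
  have e0 : N.1 0 = -(δ p ^ 2 * slopeX δ τ u p * ν) := by
    simp only [metricE, baseMetric, ← hν] at t0
    simp [formE, graph] at t0
    field_simp at t0
    simp only [slopeX]
    linarith
  have e1 : N.1 1 = -(δ p ^ 2 * slopeY δ τ u p * ν) := by
    simp only [metricE, baseMetric, ← hν] at t1
    simp [formE, graph] at t1
    field_simp at t1
    simp only [slopeY]
    linarith
  have e2 : (ν * W) ^ 2 = 1 := by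
    simp only [metricE, baseMetric, ← hν] at h2
    rw [e0, e1] at h2
    change (_ : ℝ) / δ p ^ 2 + _ = 1 at h2
    field_simp at h2
    rw [mul_pow, hW2]
    linarith
  have e3 : ν * W = 1 := by
    have := mul_pos hνpos hW
    nlinarith
  have e4 : ν = 1 / W := by field_simp; exact e3
  refine ⟨e4, ?_, ?_⟩
  · rw [e0, e4]; ring
  · rw [e1, e4]; ring

theorem christoffel_metricE {q : Space} (hδ : DifferentiableAt ℝ δ q.1)
    (hδ0 : δ q.1 ≠ 0) (hC : DifferentiableAt ℝ (calabi δ τ) q.1) (v w n : Space) :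
    christoffel (metricE δ τ) q v w n =
      ((-2 * (w.1 0 * n.1 0 + w.1 1 * n.1 1) * fderiv ℝ δ q.1 v.1 / δ q.1 ^ 3
      + (fderiv ℝ (calabi δ τ) q.1 v.1 * (q.1 1 * w.1 0 - q.1 0 * w.1 1)
          + calabi δ τ q.1 * (v.1 1 * w.1 0 - v.1 0 * w.1 1)) * formE δ τ q n
      + formE δ τ q w * (fderiv ℝ (calabi δ τ) q.1 v.1 * (q.1 1 * n.1 0 - q.1 0 * n.1 1)
          + calabi δ τ q.1 * (v.1 1 * n.1 0 - v.1 0 * n.1 1)))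
      + (-2 * (v.1 0 * n.1 0 + v.1 1 * n.1 1) * fderiv ℝ δ q.1 w.1 / δ q.1 ^ 3
      + (fderiv ℝ (calabi δ τ) q.1 w.1 * (q.1 1 * v.1 0 - q.1 0 * v.1 1)
          + calabi δ τ q.1 * (w.1 1 * v.1 0 - w.1 0 * v.1 1)) * formE δ τ q n
      + formE δ τ q v * (fderiv ℝ (calabi δ τ) q.1 w.1 * (q.1 1 * n.1 0 - q.1 0 * n.1 1)
          + calabi δ τ q.1 * (w.1 1 * n.1 0 - w.1 0 * n.1 1)))
      - (-2 * (v.1 0 * w.1 0 + v.1 1 * w.1 1) * fderiv ℝ δ q.1 n.1 / δ q.1 ^ 3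
      + (fderiv ℝ (calabi δ τ) q.1 n.1 * (q.1 1 * v.1 0 - q.1 0 * v.1 1)
          + calabi δ τ q.1 * (n.1 1 * v.1 0 - n.1 0 * v.1 1)) * formE δ τ q w
      + formE δ τ q v * (fderiv ℝ (calabi δ τ) q.1 n.1 * (q.1 1 * w.1 0 - q.1 0 * w.1 1)
          + calabi δ τ q.1 * (n.1 1 * w.1 0 - n.1 0 * w.1 1)))) / 2 := by
  rw [christoffel, fderiv_metricE hδ hδ0 hC, fderiv_metricE hδ hδ0 hC, fderiv_metricE hδ hδ0 hC]

/-- The mean curvature equation in divergence form. Both sides are expanded in the derivatives of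
`u`, `C` and `δ` with the explicit normal, and `mean_curvature_algebra` matches them. -/
theorem meanCurvature_graph_eq (hΩ : IsOpen Ω) (hδ : ContDiffOn ℝ 1 δ Ω)
    (hδpos : ∀ p ∈ Ω, 0 < δ p) (hC : ContDiffOn ℝ 1 (calabi δ τ) Ω) (hu : ContDiffOn ℝ 2 u Ω)
    (hp : p ∈ Ω) {N : Space} (hN : IsUpwardUnitNormal (metricE δ τ) (graph u) p N) :
    pd (fun q => slopeX δ τ u q * (areaElement δ τ u q)⁻¹) 0 p
      + pd (fun q => slopeY δ τ u q * (areaElement δ τ u q)⁻¹) 1 p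
    = 2 * meanCurvature (metricE δ τ) (graph u) p N * (δ p)⁻¹ ^ 2 := by
  have hdp : ∀ {f : Plane → ℝ}, ContDiffOn ℝ 1 f Ω → DifferentiableAt ℝ f p := fun hf =>
    (hf.contDiffAt (hΩ.mem_nhds hp)).differentiableAt one_ne_zero
  have hup : DifferentiableAt ℝ u p :=
    (hu.contDiffAt (hΩ.mem_nhds hp)).differentiableAt two_ne_zero
  have hd := hδpos p hp
  have hW := areaElement_pos (δ := δ) (τ := τ) (u := u) p
  have hW2 := areaElement_sq (δ := δ) (τ := τ) (u := u) p
  obtain ⟨hν, hn0, hn1⟩ := upward_normal_eq hd hup hN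
  have hpd : ∀ {f : Plane → ℝ}, ContDiffOn ℝ 1 f Ω → HasPd f p fun i => pd f i p := fun hf =>
    HasPd.of_differentiableAt (hdp hf)
  have pX : HasPd (slopeX δ τ u) p _ :=
    (hpd (contDiffOn_pd hΩ hu 0)).add ((hpd hC).mul (HasPd.coord 1 p))
  have pY : HasPd (slopeY δ τ u) p _ :=
    (hpd (contDiffOn_pd hΩ hu 1)).sub ((hpd hC).mul (HasPd.coord 0 p))
  have pW : HasPd (areaElement δ τ u) p _ :=
    ((HasPd.const 1 p).add (((hpd hδ).mul (hpd hδ)).mul ((pX.mul pX).add (pY.mul pY)))).sqrt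
      (Real.sqrt_pos.1 hW)
  have pi := pW.inv hW.ne'
  rw [(pX.mul pi).pd_eq 0, (pY.mul pi).pd_eq 1]
  have hg0 : tangent (graph u) 0 p = (EuclideanSpace.single 0 1, pd u 0 p) := tangent_graph hup 0
  have hg1 : tangent (graph u) 1 p = (EuclideanSpace.single 1 1, pd u 1 p) := tangent_graph hup 1
  have f0 : formE δ τ (graph u p) (EuclideanSpace.single 0 1, pd u 0 p) = slopeX δ τ u p := by
    simp [formE, graph, slopeX]
  have f1 : formE δ τ (graph u p) (EuclideanSpace.single 1 1, pd u 1 p) = slopeY δ τ u p := by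
    simp [formE, graph, slopeY]; ring
  have hz : ∀ a : ℝ, metricE δ τ (graph u p) (0, a) N = a * formE δ τ (graph u p) N := by
    intro a; simp [metricE, baseMetric, formE]
  have hchr := fun v w => christoffel_metricE (q := graph u p) (hdp hδ) hd.ne' (hdp hC) v w N
  have g1 : (graph u p).1 = p := rfl
  -- Here `cij` is the `j`-th partial derivative of the `i`-th coefficient of `C (y dx - x dy)`, and
  -- `uij` are the second derivatives of `u`.
  have key := mean_curvature_algebra hd hW hW2 hn0 hn1 hν
    (d0 := pd δ 0 p) (d1 := pd δ 1 p)
    (c00 := pd (calabi δ τ) 0 p * p 1) (c01 := pd (calabi δ τ) 1 p * p 1 + calabi δ τ p)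
    (c10 := -(pd (calabi δ τ) 0 p * p 0) - calabi δ τ p) (c11 := -(pd (calabi δ τ) 1 p * p 0))
    (u00 := pd (pd u 0) 0 p) (u01 := pd (pd u 0) 1 p) (u11 := pd (pd u 1) 1 p)
    (h00 := secondForm (metricE δ τ) (graph u) p N 0 0)
    (h01 := secondForm (metricE δ τ) (graph u) p N 0 1)
    (h10 := secondForm (metricE δ τ) (graph u) p N 1 0)
    (h11 := secondForm (metricE δ τ) (graph u) p N 1 1) ?_ ?_ ?_ ?_
  · have hm : meanCurvature (metricE δ τ) (graph u) p N * 2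
        = ((firstForm (metricE δ τ) (graph u) p)⁻¹
          * secondForm (metricE δ τ) (graph u) p N).trace := by
      rw [meanCurvature, div_mul_cancel₀ _ two_ne_zero]
    rw [trace_inv_mul_fin_two] at hm
    have hG : firstForm (metricE δ τ) (graph u) p 0 0 = 1 / δ p ^ 2 + slopeX δ τ u p * slopeX δ τ u p
        ∧ firstForm (metricE δ τ) (graph u) p 0 1 = slopeX δ τ u p * slopeY δ τ u p
        ∧ firstForm (metricE δ τ) (graph u) p 1 0 = slopeX δ τ u p * slopeY δ τ u p
        ∧ firstForm (metricE δ τ) (graph u) p 1 1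
          = 1 / δ p ^ 2 + slopeY δ τ u p * slopeY δ τ u p := by
      simp only [firstForm, Matrix.of_apply, hg0, hg1, metricE, f0, f1, baseMetric, g1]
      refine ⟨?_, ?_, ?_, ?_⟩
      · simp
      · simp
      · simp [mul_comm]
      · simp
    obtain ⟨G00, G01, G10, G11⟩ := hG
    rw [G00, G01, G10, G11, key] at hm
    have hm' : 2 * meanCurvature (metricE δ τ) (graph u) p N * (δ p)⁻¹ ^ 2 =
      (meanCurvature (metricE δ τ) (graph u) p N * 2) * (δ p)⁻¹ ^ 2 := by ring
    rw [hm', hm]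
    have hs : √(1 + δ p * δ p * (slopeX δ τ u p * slopeX δ τ u p + slopeY δ τ u p * slopeY δ τ u p))
      = areaElement δ τ u p := rfl
    simp only [hs, pd_comm hΩ hu hp]
    simp
    field_simp
    ring
  · simp only [secondForm, Matrix.of_apply, fderiv_tangent_graph hΩ hu hp, hz, hg0, hchr, f0,
      g1, fderiv_apply_eq]
    simp
    ring
  · simp only [secondForm, Matrix.of_apply, fderiv_tangent_graph hΩ hu hp, hz, hg0, hg1, hchr, f0,
      f1, g1, fderiv_apply_eq, pd_comm hΩ hu hp]
    simp
    ring
  · simp only [secondForm, Matrix.of_apply, fderiv_tangent_graph hΩ hu hp, hz, hg0, hg1, hchr, f0,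
      f1, g1, fderiv_apply_eq, pd_comm hΩ hu hp]
    simp
    ring
  · simp only [secondForm, Matrix.of_apply, fderiv_tangent_graph hΩ hu hp, hz, hg1, hchr, f1,
      g1, fderiv_apply_eq]
    simp
    ring

/-- The calibrating field is the pair of slopes divided by `W`; `W² = 1 + δ² (slopeX² + slopeY²)`
bounds its norm by `δ⁻¹`. -/
theorem not_isEntireGraphWithMeanCurvature (hΩ : IsOpen Ω) (hstar : StarConvex ℝ 0 Ω)
    (hconn : IsPreconnected Ω) (hδ : ContDiffOn ℝ 1 δ Ω) (hδpos : ∀ p ∈ Ω, 0 < δ p)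
    (hτ : ContDiffOn ℝ 1 τ Ω) {H : Plane → ℝ} (hH : ContinuousOn H Ω)
    (hlt : cheeger Ω δ / 2 < ⨅ p ∈ Ω, ENNReal.ofReal |H p|) :
    ¬ IsEntireGraphWithMeanCurvature Ω δ τ H u := by
  rintro ⟨hu, hN⟩
  have hC : ContDiffOn ℝ 1 (calabi δ τ) Ω := contDiffOn_calabi hΩ hstar hδ hδpos hτ
  have hX : ContDiffOn ℝ 1 (slopeX δ τ u) Ω :=
    (contDiffOn_pd hΩ hu 0).add (hC.mul (contDiffOn_coord Ω 1))
  have hY : ContDiffOn ℝ 1 (slopeY δ τ u) Ω :=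
    (contDiffOn_pd hΩ hu 1).sub (hC.mul (contDiffOn_coord Ω 0))
  have hW : ContDiffOn ℝ 1 (areaElement δ τ u) Ω :=
    (contDiffOn_const.add ((hδ.mul hδ).mul ((hX.mul hX).add (hY.mul hY)))).sqrt
      fun q _ => (Real.sqrt_pos.1 (areaElement_pos q)).ne'
  have hWi := hW.inv fun q _ => (areaElement_pos (δ := δ) (τ := τ) (u := u) q).ne'
  have hF := contDiffOn_pairField (hX.mul hWi) (hY.mul hWi)
  refine not_cheeger_lt_of_divergence hΩ hconn hδ hδpos hF (fun q hq => ?_) hH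
    (fun q hq => ?_) hlt
  · have hd := hδpos q hq
    refine norm_pairField_le (inv_nonneg.2 hd.le) ?_
    have hpos := areaElement_pos (δ := δ) (τ := τ) (u := u) q
    have hsq := areaElement_sq (δ := δ) (τ := τ) (u := u) q
    change (slopeX δ τ u q * (areaElement δ τ u q)⁻¹) ^ 2
      + (slopeY δ τ u q * (areaElement δ τ u q)⁻¹) ^ 2 ≤ _
    rw [mul_pow, mul_pow, ← add_mul, inv_pow, inv_pow, ← div_eq_mul_inv,
      div_le_iff₀ (by positivity), ← div_eq_inv_mul, le_div_iff₀ (by positivity), hsq]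
    linarith
  · obtain ⟨N, hN1, hN2⟩ := hN q hq
    rw [divergence_eq_pd ((hF.contDiffAt (hΩ.mem_nhds hq)).differentiableAt one_ne_zero), ← hN2]
    exact meanCurvature_graph_eq hΩ hδ hδpos hC hu hq hN1

end

/-! ### Projection of a spacelike surface to the base -/

section

section LocalInverse

variable {S : Type*} [TopologicalSpace S] [ChartedSpace Plane S] [IsManifold 𝓘(ℝ, Plane) 2 S]

/-- The inverse function theorem for a map from a surface to the plane. -/
theorem exists_localInverse {P : S → Plane} {s : S}
    (hP : ContMDiffAt 𝓘(ℝ, Plane) 𝓘(ℝ, Plane) 2 P s)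
    (hinj : ∀ a : TangentSpace 𝓘(ℝ, Plane) s, mfderiv 𝓘(ℝ, Plane) 𝓘(ℝ, Plane) P s a = 0 → a = 0) :
    ∃ e : OpenPartialHomeomorph S Plane, s ∈ e.source ∧ EqOn P e e.source ∧
      ContMDiffAt 𝓘(ℝ, Plane) 𝓘(ℝ, Plane) 2 e.symm (P s) := by
  set φ := chartAt Plane s with hφ
  have hs : s ∈ φ.source := mem_chart_source Plane s
  set g : Plane → Plane := P ∘ φ.symm with hg
  have hgd : ContDiffAt ℝ 2 g (φ s) := by
    have h := (contMDiffAt_iff.1 hP).2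
    rw [ModelWithCorners.range_eq_univ, contDiffWithinAt_univ] at h
    exact h
  have hmf : mfderiv 𝓘(ℝ, Plane) 𝓘(ℝ, Plane) P s = fderiv ℝ g (φ s) := by
    rw [(hP.mdifferentiableAt two_ne_zero).mfderiv]
    rw [ModelWithCorners.range_eq_univ, fderivWithin_univ]
    rfl
  have hker : LinearMap.ker (fderiv ℝ g (φ s) : Plane →ₗ[ℝ] Plane) = ⊥ := by
    rw [LinearMap.ker_eq_bot']
    intro a ha
    refine hinj a ?_
    rw [hmf]
    exact ha
  obtain ⟨L, hL⟩ : ∃ L : Plane ≃L[ℝ] Plane, (L : Plane →L[ℝ] Plane) = fderiv ℝ g (φ s) := by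
    refine ⟨(LinearEquiv.ofInjectiveEndo _ (LinearMap.ker_eq_bot.1 hker)).toContinuousLinearEquiv,
      ?_⟩
    ext a
    simp
  have hg' : HasFDerivAt g (L : Plane →L[ℝ] Plane) (φ s) := by
    rw [hL]; exact (hgd.differentiableAt two_ne_zero).hasFDerivAt
  set E := hgd.toOpenPartialHomeomorph g hg' two_ne_zero with hE
  have hEs : φ s ∈ E.source := hgd.mem_toOpenPartialHomeomorph_source hg' two_ne_zero
  have hPs : P s = g (φ s) := by simp [hg, φ.left_inv hs]
  refine ⟨φ.trans E, ?_, ?_, ?_⟩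
  · rw [OpenPartialHomeomorph.trans_source]
    exact ⟨hs, hEs⟩
  · intro x hx
    rw [OpenPartialHomeomorph.trans_source] at hx
    change P x = g (φ x)
    simp [hg, φ.left_inv hx.1]
  · have h1 : ContMDiffAt 𝓘(ℝ, Plane) 𝓘(ℝ, Plane) 2 E.symm (P s) := by
      rw [hPs]
      exact (hgd.to_localInverse hg' two_ne_zero).contMDiffAt
    have hEP : E.symm (P s) = φ s := by rw [hPs]; exact E.left_inv hEs
    have h2 : ContMDiffAt 𝓘(ℝ, Plane) 𝓘(ℝ, Plane) 2 φ.symm (E.symm (P s)) := by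
      rw [hEP]
      exact (contMDiffOn_chart_symm (x := s)).contMDiffAt
        (φ.open_target.mem_nhds (φ.map_source hs))
    exact h2.comp (P s) h1

end LocalInverse

section Lift

variable {S : Type*} [TopologicalSpace S] [ChartedSpace Plane S]
  {Ω : Set Plane} {δ τ : Plane → ℝ} {f : S → Space}

theorem IsSpacelikeImmersion.contMDiff_fst (hf : IsSpacelikeImmersion Ω δ τ f) :
    ContMDiff 𝓘(ℝ, Plane) 𝓘(ℝ, Plane) 2 fun s => (f s).1 := by
  have : ContMDiff 𝓘(ℝ, Space) 𝓘(ℝ, Plane) 2 (Prod.fst : Space → Plane) :=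
    contDiff_fst.contMDiff
  exact this.comp hf.contMDiff

theorem IsSpacelikeImmersion.mfderiv_fst (hf : IsSpacelikeImmersion Ω δ τ f) (s : S)
    (a : TangentSpace 𝓘(ℝ, Plane) s) :
    mfderiv 𝓘(ℝ, Plane) 𝓘(ℝ, Plane) (fun s => (f s).1) s a
      = Prod.fst (α := Plane) (β := ℝ) (mfderiv 𝓘(ℝ, Plane) 𝓘(ℝ, Space) f s a) := by
  have h1 := (hf.contMDiff.mdifferentiableAt two_ne_zero (x := s)).hasMFDerivAt
  have h2 : HasMFDerivAt 𝓘(ℝ, Space) 𝓘(ℝ, Plane) (Prod.fst : Space → Plane) (f s)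
      (ContinuousLinearMap.fst ℝ Plane ℝ) :=
    (hasFDerivAt_fst (p := f s)).hasMFDerivAt
  have h3 := (h2.comp s h1).mfderiv
  exact congrArg (fun L => L a) h3

/-- Dropping the negative square of the Lorentzian metric leaves the base metric of the projected
vector. Hence the projection to `M` does not shorten curves and has injective differential. -/
theorem inducedMetric_le (hf : IsSpacelikeImmersion Ω δ τ f) (s : S)
    (a : TangentSpace 𝓘(ℝ, Plane) s) {w : Plane}
    (hw : mfderiv 𝓘(ℝ, Plane) 𝓘(ℝ, Plane) (fun s => (f s).1) s a = w) :
    inducedMetric δ τ f s a a ≤ (‖w‖ / δ (f s).1) ^ 2 := by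
  rw [hf.mfderiv_fst] at hw
  simp only [inducedMetric, metricL, baseMetric]
  rw [div_pow, EuclideanSpace.norm_sq_eq, Fin.sum_univ_two]
  have := mul_self_nonneg (formL δ τ (f s) (mfderiv 𝓘(ℝ, Plane) 𝓘(ℝ, Space) f s a))
  rw [← hw]
  simp only [Real.norm_eq_abs, sq_abs]
  simp only [sq] at *
  linarith

theorem IsSpacelikeImmersion.eq_zero_of_mfderiv_fst (hf : IsSpacelikeImmersion Ω δ τ f) (s : S)
    (a : TangentSpace 𝓘(ℝ, Plane) s)
    (h : mfderiv 𝓘(ℝ, Plane) 𝓘(ℝ, Plane) (fun s => (f s).1) s a = 0) : a = 0 := by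
  by_contra hne
  have h1 := hf.spacelike s a hne
  have h2 := inducedMetric_le hf s a (w := 0) h
  rw [norm_zero, zero_div, zero_pow two_ne_zero] at h2
  linarith

theorem inducedMetric_smul (s : S) (r : ℝ) (a : TangentSpace 𝓘(ℝ, Plane) s) :
    inducedMetric δ τ f s (r • a) (r • a) = r ^ 2 * inducedMetric δ τ f s a a := by
  simp only [inducedMetric, map_smul]
  generalize hb : mfderiv 𝓘(ℝ, Plane) 𝓘(ℝ, Space) f s a = b
  have : ∀ b : Space, metricL δ τ (f s) (r • b) (r • b) = r ^ 2 * metricL δ τ (f s) b b := by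
    intro b
    simp [metricL, baseMetric, formL]
    ring
  exact this b

theorem enormSMulClass_induced (s : S) :
    letI : ENorm (TangentSpace 𝓘(ℝ, Plane) s) :=
      ⟨fun a => ENNReal.ofReal √(inducedMetric δ τ f s a a)⟩
    ENormSMulClass ℝ (TangentSpace 𝓘(ℝ, Plane) s) := by
  let _ : ENorm (TangentSpace 𝓘(ℝ, Plane) s) :=
      ⟨fun a => ENNReal.ofReal √(inducedMetric δ τ f s a a)⟩
  refine ⟨fun r a => ?_⟩
  change ENNReal.ofReal √(inducedMetric δ τ f s (r • a) (r • a))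
    = ‖r‖ₑ * ENNReal.ofReal √(inducedMetric δ τ f s a a)
  rw [inducedMetric_smul, Real.sqrt_mul (sq_nonneg r), Real.sqrt_sq_eq_abs,
    ENNReal.ofReal_mul (abs_nonneg r), ← Real.norm_eq_abs, ofReal_norm]

/-- Reversing a curve changes the sign of its velocity, which the homogeneity of the induced norm
absorbs. -/
theorem inducedEDist_comm (s t : S) : inducedEDist δ τ f s t = inducedEDist δ τ f t s := by
  let _ : ∀ r : S, ENorm (TangentSpace 𝓘(ℝ, Plane) r) :=
    fun r => ⟨fun a => ENNReal.ofReal √(inducedMetric δ τ f r a a)⟩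
  have _ : ∀ r : S, ENormSMulClass ℝ (TangentSpace 𝓘(ℝ, Plane) r) :=
    fun r => enormSMulClass_induced r
  exact Manifold.riemannianEDist_comm

variable [IsManifold 𝓘(ℝ, Plane) 2 S]

theorem IsSpacelikeImmersion.exists_localInverse (hf : IsSpacelikeImmersion Ω δ τ f) (s : S) :
    ∃ e : OpenPartialHomeomorph S Plane, s ∈ e.source ∧ EqOn (fun s => (f s).1) e e.source ∧
      ContMDiffAt 𝓘(ℝ, Plane) 𝓘(ℝ, Plane) 2 e.symm (f s).1 :=
  GBCV.exists_localInverse (hf.contMDiff_fst s) (hf.eq_zero_of_mfderiv_fst s)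

theorem IsSpacelikeImmersion.isLocalHomeomorph (hf : IsSpacelikeImmersion Ω δ τ f) :
    IsLocalHomeomorph fun s => (f s).1 :=
  IsLocalHomeomorph.mk _ fun s =>
    let ⟨e, h1, h2, _⟩ := hf.exists_localInverse s
    ⟨e, h1, h2⟩

/-- A continuous lift of a smooth map is smooth. -/
theorem IsSpacelikeImmersion.contMDiffWithinAt_lift (hf : IsSpacelikeImmersion Ω δ τ f)
    {E : Type*} [NormedAddCommGroup E] [NormedSpace ℝ E] {n : ℕ∞ω} (hn : n ≤ 2) {A : Set E}
    {c : E → Plane} {γ : E → S} {t : E} (ht : t ∈ A) (hc : ContDiffWithinAt ℝ n c A t)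
    (hγ : ContinuousWithinAt γ A t) (hlift : ∀ t ∈ A, (f (γ t)).1 = c t) :
    ContMDiffWithinAt 𝓘(ℝ, E) 𝓘(ℝ, Plane) n γ A t := by
  obtain ⟨e, h1, h2, h3⟩ := hf.exists_localInverse (γ t)
  have heq : γ =ᶠ[𝓝[A] t] fun x => e.symm (c x) := by
    filter_upwards [hγ.preimage_mem_nhdsWithin (e.open_source.mem_nhds h1), self_mem_nhdsWithin]
      with x hx hxA
    rw [← hlift x hxA]
    have := h2 hx
    simp only at this
    rw [this, e.left_inv hx]
  rw [hlift t ht] at h3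
  refine ContMDiffWithinAt.congr_of_eventuallyEq ?_ heq (heq.self_of_nhdsWithin ht)
  exact (h3.of_le hn).comp_contMDiffWithinAt t hc.contMDiffWithinAt

/-- A lift of a straight segment is no longer than the segment. -/
theorem IsSpacelikeImmersion.inducedEDist_lift_le (hf : IsSpacelikeImmersion Ω δ τ f)
    (hδpos : ∀ p ∈ Ω, 0 < δ p) {x v : Plane} {γ : ℝ → S} {a b K : ℝ} (hab : a ≤ b)
    (hγ : ContinuousOn γ (Icc a b)) (hlift : ∀ t ∈ Icc a b, (f (γ t)).1 = x + t • v)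
    (hK : ∀ t ∈ Icc a b, ‖v‖ / δ (x + t • v) ≤ K) :
    inducedEDist δ τ f (γ a) (γ b) ≤ ENNReal.ofReal (K * (b - a)) := by
  let _ : ∀ r : S, ENorm (TangentSpace 𝓘(ℝ, Plane) r) :=
    fun r => ⟨fun a => ENNReal.ofReal √(inducedMetric δ τ f r a a)⟩
  have _ : ∀ r : S, ENormSMulClass ℝ (TangentSpace 𝓘(ℝ, Plane) r) :=
    fun r => enormSMulClass_induced r
  have hc : ContDiff ℝ 1 fun t : ℝ => x + t • v := by fun_prop
  have hsm : ContMDiffOn 𝓘(ℝ, ℝ) 𝓘(ℝ, Plane) 1 γ (Icc a b) := fun t ht =>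
    hf.contMDiffWithinAt_lift (by norm_num) ht hc.contDiffAt.contDiffWithinAt (hγ t ht) hlift
  have h1 : inducedEDist δ τ f (γ a) (γ b) ≤ Manifold.pathELength 𝓘(ℝ, Plane) γ a b :=
    Manifold.riemannianEDist_le_pathELength hsm rfl rfl hab
  refine h1.trans ?_
  rw [Manifold.pathELength_eq_lintegral_mfderiv_Ioo]
  -- The velocity of the lift projects to `v`, so its induced norm is at most `‖v‖ / δ`.
  have hbound : ∀ t ∈ Ioo a b, ‖mfderiv 𝓘(ℝ, ℝ) 𝓘(ℝ, Plane) γ t 1‖ₑ ≤ ENNReal.ofReal K := by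
    intro t ht
    have ht' := Ioo_subset_Icc_self ht
    have hmd : MDifferentiableAt 𝓘(ℝ, ℝ) 𝓘(ℝ, Plane) γ t :=
      ((hsm t ht').contMDiffAt (Icc_mem_nhds ht.1 ht.2)).mdifferentiableAt one_ne_zero
    have hcomp := ((hf.contMDiff_fst.mdifferentiableAt two_ne_zero
      (x := γ t)).hasMFDerivAt.comp t hmd.hasMFDerivAt)
    have heq : (fun t : ℝ => x + t • v) =ᶠ[𝓝 t] ((fun s => (f s).1) ∘ γ) := by
      filter_upwards [Icc_mem_nhds ht.1 ht.2] with y hy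
      exact (hlift y hy).symm
    have hd : HasMFDerivAt 𝓘(ℝ, ℝ) 𝓘(ℝ, Plane) (fun t : ℝ => x + t • v) t
        (ContinuousLinearMap.toSpanSingleton ℝ v) := by
      have : HasDerivAt (fun t : ℝ => x + t • v) v t := by
        simpa using ((hasDerivAt_id t).smul_const v).const_add x
      exact this.hasFDerivAt.hasMFDerivAt
    have hv : mfderiv 𝓘(ℝ, Plane) 𝓘(ℝ, Plane) (fun s => (f s).1) (γ t)
        (mfderiv 𝓘(ℝ, ℝ) 𝓘(ℝ, Plane) γ t 1) = v := by
      have := hasMFDerivAt_unique (hcomp.congr_of_eventuallyEq heq) hd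
      have h2 := congrArg (fun L => L (1 : ℝ)) this
      refine Eq.trans ?_ (h2.trans ?_)
      · rfl
      · exact one_smul ℝ v
    have hle := inducedMetric_le hf (γ t) (mfderiv 𝓘(ℝ, ℝ) 𝓘(ℝ, Plane) γ t 1) hv
    rw [hlift t ht'] at hle
    change ENNReal.ofReal √(inducedMetric δ τ f (γ t) _ _) ≤ _
    refine ENNReal.ofReal_le_ofReal ((Real.sqrt_le_left ?_).2 (hle.trans ?_))
    · exact (Real.sqrt_nonneg _).trans (Real.sqrt_le_sqrt hle |>.trans (by
        rw [Real.sqrt_sq]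
        · exact hK t ht'
        · have := hδpos _ (hf.mem (γ t))
          rw [hlift t ht'] at this
          positivity))
    · have := hδpos _ (hf.mem (γ t))
      rw [hlift t ht'] at this
      exact pow_le_pow_left₀ (by positivity) (hK t ht') 2
  calc ∫⁻ t in Ioo a b, ‖mfderiv 𝓘(ℝ, ℝ) 𝓘(ℝ, Plane) γ t 1‖ₑ
      ≤ ∫⁻ _ in Ioo a b, ENNReal.ofReal K := setLIntegral_mono' measurableSet_Ioo hbound
    _ = ENNReal.ofReal K * ENNReal.ofReal (b - a) := by simp
    _ = ENNReal.ofReal (K * (b - a)) := by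
      rw [ENNReal.ofReal_mul' (by linarith)]

end Lift

end

/-! ### Lifting of segments -/

section

/-- `γ` is a continuous lift through `P` of the curve `c` over `[0, T]`, starting at `s₀`. -/
structure IsLift {S X : Type*} [TopologicalSpace S] (P : S → X) (c : ℝ → X) (s₀ : S) (T : ℝ)
    (γ : ℝ → S) : Prop where
  continuousOn : ContinuousOn γ (Icc 0 T)
  start : γ 0 = s₀
  lifts : ∀ t ∈ Icc 0 T, P (γ t) = c t

section IsLift

variable {S X : Type*} [TopologicalSpace S] {P : S → X} {c : ℝ → X} {s₀ : S}
  {γ γ' : ℝ → S} {a b : ℝ}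

theorem IsLift.mono (h : IsLift P c s₀ b γ) (hab : a ≤ b) : IsLift P c s₀ a γ :=
  ⟨h.continuousOn.mono (Icc_subset_Icc_right hab), h.start,
    fun t ht => h.lifts t (Icc_subset_Icc_right hab ht)⟩

variable [TopologicalSpace X]

theorem IsLift.eq [T2Space S] (hP : IsLocalHomeomorph P) (h : IsLift P c s₀ a γ)
    (h' : IsLift P c s₀ a γ') {t : ℝ} (ht : t ∈ Icc 0 a) : γ t = γ' t := by
  have hsep : IsSeparatedMap P := T2Space.isSeparatedMap P
  refine hsep.eqOn_of_comp_eqOn hP.isLocallyInjective isPreconnected_Icc h.continuousOn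
    h'.continuousOn (fun t ht => ?_) (a := 0) ⟨le_rfl, ht.1.trans ht.2⟩
    (h.start.trans h'.start.symm) ht
  simp only [Function.comp, h.lifts t ht, h'.lifts t ht]

/-- After time `a` the lift is continued by the local section `e.symm`, which agrees with `γ` at
`a`. -/
theorem IsLift.extend (h : IsLift P c s₀ a γ) (ha : 0 ≤ a) (hab : a ≤ b)
    (hc : ContinuousOn c (Icc a b)) (e : OpenPartialHomeomorph S X) (he : EqOn P e e.source)
    (hγ : γ a ∈ e.source) (htar : ∀ t ∈ Icc a b, c t ∈ e.target) :
    ∃ γ', IsLift P c s₀ b γ' := by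
  have hj : e.symm (c a) = γ a := by
    rw [← h.lifts a ⟨ha, le_rfl⟩, he hγ, e.left_inv hγ]
  set γ' : ℝ → S := fun t => if t ≤ a then γ t else e.symm (c t) with hγ'
  have h1 : EqOn γ' γ (Icc 0 a) := fun t ht => by simp [hγ', ht.2]
  have h2 : EqOn γ' (fun t => e.symm (c t)) (Icc a b) := by
    intro t ht
    rcases ht.1.eq_or_lt with rfl | hlt
    · simp [hγ', hj]
    · simp [hγ', not_le.2 hlt]
  have hcont2 : ContinuousOn (fun t => e.symm (c t)) (Icc a b) :=
    e.continuousOn_symm.comp hc htar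
  refine ⟨γ', ?_, ?_, ?_⟩
  · rw [← Icc_union_Icc_eq_Icc ha hab]
    exact (h.continuousOn.congr h1).union_of_isClosed (hcont2.congr h2) isClosed_Icc isClosed_Icc
  · rw [h1 ⟨le_rfl, ha⟩, h.start]
  · intro t ht
    rcases le_total t a with hta | hta
    · rw [h1 ⟨ht.1, hta⟩]
      exact h.lifts t ⟨ht.1, hta⟩
    · have hm := htar t ⟨hta, ht.2⟩
      rw [h2 ⟨hta, ht.2⟩]
      simp only
      rw [he (e.map_target hm), e.right_inv hm]

end IsLift

variable {S : Type*} [TopologicalSpace S] [T2Space S] [ChartedSpace Plane S]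
  [IsManifold 𝓘(ℝ, Plane) 2 S] {Ω : Set Plane} {δ τ : Plane → ℝ} {f : S → Space}

/-- Completeness yields the lifting of straight segments. -/
theorem IsSpacelikeImmersion.exists_isLift (hf : IsSpacelikeImmersion Ω δ τ f)
    (hcomp : IsInducedComplete δ τ f) (hδ : ContinuousOn δ Ω) (hδpos : ∀ p ∈ Ω, 0 < δ p)
    {x v : Plane} (hseg : ∀ t ∈ Icc (0 : ℝ) 1, x + t • v ∈ Ω) {s₀ : S} (hs₀ : (f s₀).1 = x) :
    ∃ γ, IsLift (fun s => (f s).1) (fun t : ℝ => x + t • v) s₀ 1 γ := by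
  set P : S → Plane := fun s => (f s).1 with hP
  set c : ℝ → Plane := fun t => x + t • v with hc
  have hcc : Continuous c := by fun_prop
  have hPl : IsLocalHomeomorph P := hf.isLocalHomeomorph
  obtain ⟨K, hK⟩ : ∃ K, ∀ t ∈ Icc (0 : ℝ) 1, ‖v‖ / δ (c t) ≤ K := by
    have hcont : ContinuousOn (fun t => ‖v‖ / δ (c t)) (Icc 0 1) :=
      continuousOn_const.div (hδ.comp hcc.continuousOn hseg) fun t ht => (hδpos _ (hseg t ht)).ne'
    obtain ⟨K, hK⟩ := isCompact_Icc.bddAbove_image hcont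
    exact ⟨K, fun t ht => hK (mem_image_of_mem _ ht)⟩
  -- Continuity method: the supremum `T` of the times up to which a lift exists is shown to be
  -- attained and equal to one.
  set A : Set ℝ := {T | T ∈ Icc (0 : ℝ) 1 ∧ ∃ γ, IsLift P c s₀ T γ} with hA
  have h0A : (0 : ℝ) ∈ A := by
    refine ⟨⟨le_rfl, zero_le_one⟩, fun _ => s₀, continuousOn_const, rfl, fun t ht => ?_⟩
    have : t = 0 := le_antisymm ht.2 ht.1
    simp [hP, hc, this, hs₀]
  have hbdd : BddAbove A := ⟨1, fun T hT => hT.1.2⟩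
  set T := sSup A with hT
  have hT0 : 0 ≤ T := le_csSup hbdd h0A
  have hT1 : T ≤ 1 := csSup_le ⟨0, h0A⟩ fun T hT => hT.1.2
  -- These times increase to `T` and, if `T > 0`, stay strictly below it, so a lift exists up to
  -- each of them; if `T = 0` they are all zero.
  set t : ℕ → ℝ := fun n => T * (1 - 1 / ((n : ℝ) + 2)) with ht
  have hfrac : ∀ n : ℕ, 0 < 1 / ((n : ℝ) + 2) ∧ 1 / ((n : ℝ) + 2) ≤ 1 := fun n => by
    refine ⟨by positivity, ?_⟩
    rw [div_le_one (by positivity)]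
    linarith [(Nat.cast_nonneg n : (0 : ℝ) ≤ n)]
  have ht0 : ∀ n, 0 ≤ t n := fun n => mul_nonneg hT0 (by linarith [(hfrac n).2])
  have htT : ∀ n, t n ≤ T := fun n =>
    mul_le_of_le_one_right hT0 (by linarith [(hfrac n).1])
  have htmono : Monotone t := by
    intro m n hmn
    refine mul_le_mul_of_nonneg_left ?_ hT0
    have : 1 / ((n : ℝ) + 2) ≤ 1 / ((m : ℝ) + 2) := by
      have : (m : ℝ) ≤ n := by exact_mod_cast hmn
      gcongr
    linarith
  have htlim : Tendsto t atTop (𝓝 T) := by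
    have h1 : Tendsto (fun n : ℕ => 1 / ((n : ℝ) + 2)) atTop (𝓝 0) := by
      have := (tendsto_one_div_add_atTop_nhds_zero_nat (𝕜 := ℝ)).comp (tendsto_add_atTop_nat 1)
      refine this.congr fun n => ?_
      simp only [Function.comp, Nat.cast_add, Nat.cast_one]
      ring
    have := (h1.const_sub 1).const_mul T
    rwa [sub_zero, mul_one] at this
  have htA : ∀ n, ∃ γ, IsLift P c s₀ (t n) γ := by
    intro n
    rcases hT0.eq_or_lt with h | h
    · have : t n = 0 := by simp [ht, ← h]
      rw [this]
      exact h0A.2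
    · have hlt : t n < T := by
        have := (hfrac n).1
        simp only [ht]
        nlinarith
      obtain ⟨a, ⟨-, γ, hγ⟩, hlt'⟩ := exists_lt_of_lt_csSup ⟨0, h0A⟩ hlt
      exact ⟨γ, hγ.mono hlt'.le⟩
  choose γ hγ using htA
  set σ : ℕ → S := fun n => γ n (t n) with hσ
  have hdist : ∀ m n, m ≤ n → inducedEDist δ τ f (σ m) (σ n)
      ≤ ENNReal.ofReal (K * (t n - t m)) := by
    intro m n hmn
    have hmn' := htmono hmn
    -- By uniqueness of lifts both endpoints lie on the lift `γ n`, whose length between them bounds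
    -- the distance.
    have e1 : σ m = γ n (t m) := (hγ m).eq hPl ((hγ n).mono hmn') ⟨ht0 m, le_rfl⟩
    rw [e1]
    refine hf.inducedEDist_lift_le hδpos (x := x) (v := v) hmn'
      ((hγ n).continuousOn.mono (Icc_subset_Icc_left (ht0 m)))
      (fun r hr => (hγ n).lifts r ⟨(ht0 m).trans hr.1, hr.2⟩)
      (fun r hr => hK r ⟨(ht0 m).trans hr.1, hr.2.trans ((htT n).trans hT1)⟩)
  have hK0 : 0 ≤ K := by
    have := hδpos _ (hseg 0 ⟨le_rfl, zero_le_one⟩)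
    exact le_trans (by positivity) (hK 0 ⟨le_rfl, zero_le_one⟩)
  have hlimK : Tendsto (fun N => ENNReal.ofReal (K * (T - t N))) atTop (𝓝 0) := by
    have h1 : Tendsto (fun N => K * (T - t N)) atTop (𝓝 (K * (T - T))) :=
      (htlim.const_sub T).const_mul K
    rw [sub_self, mul_zero] at h1
    have := (ENNReal.continuous_ofReal.tendsto _).comp h1
    rwa [ENNReal.ofReal_zero] at this
  obtain ⟨s, hs⟩ := hcomp σ (by
    intro ε hε
    obtain ⟨N, hN⟩ := ((tendsto_order.1 hlimK).2 ε hε).exists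
    refine ⟨N, fun m hm n hn => lt_of_le_of_lt ?_ hN⟩
    have key : ∀ m n, N ≤ m → m ≤ n →
        inducedEDist δ τ f (σ m) (σ n) ≤ ENNReal.ofReal (K * (T - t N)) := by
      intro m n hNm hmn
      refine (hdist m n hmn).trans (ENNReal.ofReal_le_ofReal ?_)
      refine mul_le_mul_of_nonneg_left ?_ hK0
      linarith [htT n, htmono hNm]
    rcases le_total m n with h | h
    · exact key m n hm h
    · rw [inducedEDist_comm]
      exact key n m hn h)
  have hPs : P s = c T := by
    have h1 : Tendsto (fun n => P (σ n)) atTop (𝓝 (P s)) :=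
      (hPl.continuous.tendsto s).comp hs
    have h2 : Tendsto (fun n => P (σ n)) atTop (𝓝 (c T)) := by
      refine ((hcc.tendsto T).comp htlim).congr fun n => ?_
      exact ((hγ n).lifts (t n) ⟨ht0 n, le_rfl⟩).symm
    exact tendsto_nhds_unique h1 h2
  -- A local section at the limit `s` continues some lift from `t n`, where `σ n` is already in its
  -- domain, to a time `b ≥ T`. By maximality `b ≤ T`, which forces `b = 1`.
  obtain ⟨e, hes, hee, -⟩ := hf.exists_localInverse s
  have hcT : c T ∈ e.target := by
    rw [← hPs, show P s = e s from hee hes]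
    exact e.map_source hes
  obtain ⟨η, hη, hball⟩ := Metric.mem_nhds_iff.1
    (hcc.continuousAt.preimage_mem_nhds (e.open_target.mem_nhds hcT))
  obtain ⟨n, hn1, hn2⟩ := ((hs.eventually (e.open_source.mem_nhds hes)).and
    (htlim.eventually (Metric.ball_mem_nhds T hη))).exists
  set b := min 1 (T + η / 2) with hb
  have hTb : T ≤ b := le_min hT1 (by linarith)
  have hbA : b ∈ A := by
    refine ⟨⟨hT0.trans hTb, min_le_left _ _⟩, ?_⟩
    refine (hγ n).extend (ht0 n) ((htT n).trans hTb) hcc.continuousOn e hee hn1 fun r hr => ?_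
    refine hball ?_
    rw [Metric.mem_ball, Real.dist_eq, abs_lt]
    rw [Real.dist_eq, abs_lt] at hn2
    have := min_le_right 1 (T + η / 2)
    constructor <;> linarith [hr.1, hr.2]
  have hbT : b ≤ T := le_csSup hbdd hbA
  have hb1 : b = 1 := by
    rcases min_choice 1 (T + η / 2) with h | h
    · exact h
    · rw [← hb] at h; linarith
  rw [← hb1]
  exact hbA.2

/-- A complete spacelike surface contains an entire spacelike graph. -/
theorem IsSpacelikeImmersion.exists_isEntireSpacelikeGraph [Nonempty S]
    (hf : IsSpacelikeImmersion Ω δ τ f) (hcomp : IsInducedComplete δ τ f) (hΩ : IsOpen Ω)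
    (hstar : StarConvex ℝ 0 Ω) (hδ : ContinuousOn δ Ω) (hδpos : ∀ p ∈ Ω, 0 < δ p) :
    ∃ u, IsEntireSpacelikeGraph Ω δ τ u := by
  classical
  obtain ⟨s₁⟩ := ‹Nonempty S›
  -- Lifting the segment from the projection of `s₁` to the origin produces a point above the
  -- origin.
  obtain ⟨γ₁, hγ₁⟩ := hf.exists_isLift hcomp hδ hδpos (x := (f s₁).1) (v := -(f s₁).1)
    (fun t ht => by
      have : (f s₁).1 + t • (-(f s₁).1) = (1 - t) • (f s₁).1 := by
        rw [sub_smul, one_smul, smul_neg, sub_eq_add_neg]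
      rw [this]
      exact hstar.smul_mem (hf.mem s₁) (by linarith [ht.2]) (by linarith [ht.1])) rfl
  set s₀ := γ₁ 1
  have hs₀ : (f s₀).1 = 0 := by
    have := hγ₁.lifts 1 ⟨zero_le_one, le_rfl⟩
    simpa using this
  have hray : ∀ q : Ω, ∃ γ, IsLift (fun s => (f s).1) (fun t : ℝ => 0 + t • (q : Plane)) s₀ 1 γ :=
    fun q => hf.exists_isLift hcomp hδ hδpos
      (fun t ht => by rw [zero_add]; exact hstar.smul_mem q.2 ht.1 ht.2) hs₀
  choose γ hγ using hray
  -- The lifted rays start at the same point and each is continuous in time; for a separated local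
  -- homeomorphism this makes them jointly continuous in time and endpoint.
  have hgc : Continuous fun z : unitInterval × Ω => γ z.2 z.1 := by
    refine hf.isLocalHomeomorph.continuous_lift (T2Space.isSeparatedMap _)
      ⟨fun z : unitInterval × Ω => (z.1 : ℝ) • (z.2 : Plane), by fun_prop⟩ ?_ ?_ ?_
    · ext1 z
      have := (hγ z.2).lifts z.1 z.1.2
      simpa using this
    · have : (fun q : Ω => γ q ((0 : unitInterval) : ℝ)) = fun _ => s₀ :=
        funext fun q => (hγ q).start
      exact this ▸ continuous_const
    · intro q
      exact (hγ q).continuousOn.comp_continuous continuous_subtype_val fun t => t.2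
  -- The section of endpoints of the lifted rays; its value `s₀` outside `Ω` plays no role.
  set σ : Plane → S := fun q => if h : q ∈ Ω then γ ⟨q, h⟩ 1 else s₀ with hσ
  have hσc : ContinuousOn σ Ω := by
    rw [continuousOn_iff_continuous_domRestrict]
    have h1 : Continuous fun q : Ω => γ q ((1 : unitInterval) : ℝ) :=
      hgc.comp (by fun_prop : Continuous fun q : Ω => ((1 : unitInterval), q))
    refine h1.congr fun q => ?_
    simp [hσ]
  have hσl : ∀ q ∈ Ω, (f (σ q)).1 = q := by
    intro q hq
    have := (hγ ⟨q, hq⟩).lifts 1 ⟨zero_le_one, le_rfl⟩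
    simpa [hσ, hq] using this
  have hσd : ∀ q ∈ Ω, ContMDiffAt 𝓘(ℝ, Plane) 𝓘(ℝ, Plane) 2 σ q := fun q hq =>
    (hf.contMDiffWithinAt_lift le_rfl (c := id) hq contDiffWithinAt_id (hσc q hq)
      hσl).contMDiffAt (hΩ.mem_nhds hq)
  have hfσ : ∀ q ∈ Ω, ContMDiffAt 𝓘(ℝ, Plane) 𝓘(ℝ, Space) 2 (fun q => f (σ q)) q := fun q hq =>
    (hf.contMDiff (σ q)).comp q (hσd q hq)
  refine ⟨fun q => (f (σ q)).2, fun q hq => ?_, fun q hq a ha => ?_⟩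
  · exact (contDiff_snd.contDiffAt.comp q (hfσ q hq).contDiffAt).contDiffWithinAt
  · have heq : graph (fun q => (f (σ q)).2) =ᶠ[𝓝 q] fun q => f (σ q) := by
      filter_upwards [hΩ.mem_nhds hq] with x hx
      exact Prod.ext (hσl x hx).symm rfl
    have hσm := ((hσd q hq).mdifferentiableAt two_ne_zero).hasMFDerivAt
    have hcomp1 := (hf.contMDiff.mdifferentiableAt two_ne_zero (x := σ q)).hasMFDerivAt.comp q hσm
    have hfd : fderiv ℝ (fun q => f (σ q)) q a = mfderiv 𝓘(ℝ, Plane) 𝓘(ℝ, Space) f (σ q)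
        (mfderiv 𝓘(ℝ, Plane) 𝓘(ℝ, Plane) σ q a) := by
      rw [← mfderiv_eq_fderiv]
      exact congrArg (fun L => L a) hcomp1.mfderiv
    -- Near `q` the graph is `f ∘ σ`, and a graph is an immersion, so `σ` has injective
    -- differential.
    have hne : mfderiv 𝓘(ℝ, Plane) 𝓘(ℝ, Plane) σ q a ≠ 0 := by
      intro h0
      rw [h0, map_zero] at hfd
      have h1 : fderiv ℝ (graph fun q => (f (σ q)).2) q a = 0 := by
        rw [heq.fderiv_eq]; exact hfd
      have hu : DifferentiableAt ℝ (fun q => (f (σ q)).2) q :=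
        (contDiff_snd.contDiffAt.comp q (hfσ q hq).contDiffAt).differentiableAt two_ne_zero
      rw [fderiv_graph hu] at h1
      exact ha (congrArg Prod.fst h1)
    have hpos := hf.spacelike (σ q) _ hne
    rw [heq.self_of_nhds, heq.fderiv_eq, hfd]
    exact hpos

end

end GBCV

end

theorem theorem4p4 (Ω : Set GBCV.Plane) (hΩ : IsOpen Ω) (h0 : (0 : GBCV.Plane) ∈ Ω)
    (hstar : StarConvex ℝ 0 Ω)
    (δ : GBCV.Plane → ℝ) (hδ : ContDiffOn ℝ ∞ δ Ω) (hδpos : ∀ p ∈ Ω, 0 < δ p) :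
    (∀ H : GBCV.Plane → ℝ, ContDiffOn ℝ ∞ H Ω →
      GBCV.cheeger Ω δ / 2 < ⨅ p ∈ Ω, ENNReal.ofReal |H p| →
      ∀ τ : GBCV.Plane → ℝ, ContDiffOn ℝ ∞ τ Ω →
        ¬ ∃ u : GBCV.Plane → ℝ, GBCV.IsEntireGraphWithMeanCurvature Ω δ τ H u) ∧
    (∀ τ : GBCV.Plane → ℝ, ContDiffOn ℝ ∞ τ Ω →
      GBCV.cheeger Ω δ / 2 < ⨅ p ∈ Ω, ENNReal.ofReal |τ p| →
      (∀ (S : Type*) [TopologicalSpace S] [T2Space S] [SecondCountableTopology S] [Nonempty S]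
        [ChartedSpace GBCV.Plane S] [IsManifold 𝓘(ℝ, GBCV.Plane) 2 S] (f : S → GBCV.Space),
        GBCV.IsSpacelikeImmersion Ω δ τ f → ¬ GBCV.IsInducedComplete δ τ f) ∧
      ¬ ∃ u : GBCV.Plane → ℝ, GBCV.IsEntireSpacelikeGraph Ω δ τ u) := by
  have hconn : IsPreconnected Ω := (hstar.isPathConnected h0).isConnected.isPreconnected
  have hδ1 : ContDiffOn ℝ 1 δ Ω := hδ.of_le (by simp)
  refine ⟨fun H hH hlt τ hτ => ?_, fun τ hτ hlt => ⟨?_, ?_⟩⟩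
  · rintro ⟨u, hu⟩
    exact GBCV.not_isEntireGraphWithMeanCurvature hΩ hstar hconn hδ1 hδpos (hτ.of_le (by simp))
      hH.continuousOn hlt hu
  · intro S _ _ _ _ _ _ f hf hcomp
    obtain ⟨u, hu⟩ := hf.exists_isEntireSpacelikeGraph hcomp hΩ hstar hδ.continuousOn hδpos
    exact GBCV.not_isEntireSpacelikeGraph hΩ hstar hconn hδ1 hδpos (hτ.of_le (by simp)) hlt hu
  · rintro ⟨u, hu⟩
    exact GBCV.not_isEntireSpacelikeGraph hΩ hstar hconn hδ1 hδpos (hτ.of_le (by simp)) hlt hu
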